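/- Let $D\subset\mathbb R$ be compact and let $\mathcal M$ be a compact smooth Riemannian manifold of dimension $d\ge 1$, possibly with boundary $\partial\mathcal M$, isometrically embedded in $L^2(D)$; identify $\mathcal M$ with its image and write $\mathfrak d$ for its Riemannian distance and $\|\cdot\|$ for the norm of $L^2(D)$. Let $X_1,X_2,\dots$ be i.i.d. random elements of $\mathcal M$ and let $Y_i=g(X_i)+\varepsilon_i$, where the errors $\varepsilon_i$ are i.i.d. with mean zero and finite variance. For each $n$ let $\hat X_1,\dots,\hat X_n$ (depending on $n$) be $L^2(D)$-valued contaminated versions of $X_1,\dots,X_n$; put $\mathscr X=\{(X_1,\hat X_1),\dots,(X_n,\hat X_n)\}$ and assume that $(\varepsilon_1,\dots,\varepsilon_n)$ is independent of $\mathscr X$. Assume: (A1) $K\ge 0$ is a symmetric, compactly supported probability density on $\mathbb R$, differentiable with bounded derivative, with $\int_{-1}^1K(u)\,du=1$, $\int_{-1}^1uK(u)\,du=0$ and $\int_{-1}^1|u|^pK(u)\,du<\infty$ for all $p>0$. (B1) $X_i$ has a density $f$ with respect to the Riemannian volume of $\mathcal M$, bounded above and bounded away from zero on $\mathcal M$.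 (B2) $g:\mathcal M\to\mathbb R$ is twice differentiable with a bounded second derivative. (B3) For each $n$, $\hat X_1,\dots,\hat X_n$ are i.i.d.; and there are $\beta\in(0,\infty)$, a measurable function $\eta\ge 0$ on $\mathcal M$ with $\mathbf E\{\eta(X_i)^p\}<\infty$ for all $p\ge 1$, and constants $C_p$ depending only on $p$, such that $\{\mathbf E(\|\hat X_i-X_i\|^p\mid X_i)\}^{1/p}\le C_pn^{-\beta}\eta(X_i)$ almost surely for all $p\ge 1$, all $n$ and all $i\le n$. *The estimator.* Let $\hat d$ be an $\mathbb N$-valued statistic (an estimator of $d$) and let $x\in\mathcal M$. Given bandwidths $h_{pca}$ and $h_{reg}$, let $\hat\varphi_1,\dots,\hat\varphi_{\hat d}$ be orthonormal eigenfunctions, for the $\hat d$ largest eigenvalues, of the empirical covariance operator of those $\hat X_i$ with $\|x-\hat X_i\|<h_{pca}$; $\hat d$ and the $\hat\varphi_k$ are $\mathscr X$-measurable. Let $\hat{\mathbf x}_i=(\langle\hat X_i-x,\hat\varphi_1\rangle,\dots,\langle\hat X_i-x,\hat\varphi_{\hat d}\rangle)^T$, let $\hat{\mathbf X}$ be the $n\times(\hat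 d+1)$ matrix with rows $(1,\hat{\mathbf x}_i^T)$, let $\hat{\mathbf W}=\mathrm{diag}\{K(\|x-\hat X_i\|/h_{reg})/h_{reg}^{\hat d}\}_{i\le n}$, $\mathbf Y=(Y_1,\dots,Y_n)^T$, and $$\hat g(x)=\mathbf e_1^T(\hat{\mathbf X}^T\hat{\mathbf W}\hat{\mathbf X})^{-1}\hat{\mathbf X}^T\hat{\mathbf W}\mathbf Y .$$ *Claim.* Let $h_{pca}\asymp n^{-\varrho}$ with $\varrho=1/(d+2)$ if $\beta\ge 2/d$ and $\varrho=\beta/2$ otherwise. Let $\epsilon>0$, and choose $h_{reg}\asymp n^{-1/(d+4)}$ if $\beta>3/(d+4)$ and $h_{reg}\asymp n^{-\beta/(3+\epsilon d)}$ if $\beta\le 3/(d+4)$. Let $x=x_n\in\mathcal M\setminus\mathcal M_{h_{reg}}$ for all large $n$, where $\mathcal M_h=\{x\in\mathcal M:\inf_{y\in\partial\mathcal M}\mathfrak d(x,y)\le h\}$ (empty if $\partial\mathcal M=\emptyset$). Then, on the event $\{\hat d=d\}$, $$\mathbf E\left[\{\hat g(x)-g(x)\}^2\mid\mathscr X\right]=O_P\left(n^{-\frac{4}{d+4}}+n^{-\frac{4\beta}{3+\epsilon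 d}}\right),$$ that is, the left-hand side multiplied by the indicator of $\{\hat d=d\}$ is of this order in probability. (The two regimes are separated at the contamination level $\beta^{-1}=\gamma_0=(d+4)/3$.) -/

import Mathlib

open MeasureTheory ProbabilityTheory Filter Set
open scoped Manifold ENNReal Topology

noncomputable section

namespace FREM

/-! ### Asymptotic notation -/

/-- `a ≍ b` for sequences (`b` eventually positive): the ratio `a n / b n` is eventually bounded and
bounded away from zero. -/
def Asymp (a b : ℕ → ℝ) : Prop :=
  ∃ c C : ℝ, 0 < c ∧ 0 < C ∧ ∀ᶠ n in atTop, c * b n ≤ a n ∧ a n ≤ C * b n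

/-- `R n = O_P(a n)` for nonnegative random variables `R n`: for every `δ > 0` there is `C > 0` such
that `P(R n > C * a n) ≤ δ` for all large `n`. -/
def IsBigOP {Ω : Type*} [MeasurableSpace Ω] (μ : Measure Ω) (R : ℕ → Ω → ℝ≥0∞) (a : ℕ → ℝ) :
    Prop :=
  ∀ δ : ℝ, 0 < δ → ∃ C : ℝ, 0 < C ∧
    ∀ᶠ n in atTop, μ {ω | ENNReal.ofReal (C * a n) < R n ω} ≤ ENNReal.ofReal δ

/-! ### The kernel -/

/-- A compactly supported symmetric probability density, differentiable with bounded derivative,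
with total mass one and mean zero on `[-1, 1]`. -/
structure IsSmoothingKernel (K : ℝ → ℝ) : Prop where
  nonneg : ∀ u, 0 ≤ K u
  symm : ∀ u, K (-u) = K u
  compactSupport : HasCompactSupport K
  density : ∫ u, K u = 1
  differentiable : Differentiable ℝ K
  bounded_deriv : ∃ B : ℝ, ∀ u, |deriv K u| ≤ B
  mass : ∫ u in (-1 : ℝ)..1, K u = 1
  mean : ∫ u in (-1 : ℝ)..1, u * K u = 0
  moments : ∀ p : ℝ, 0 < p → IntervalIntegrable (fun u => |u| ^ p * K u) volume (-1) 1

/-! ### Geometry of the embedded manifold (possibly with boundary) -/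

section Geometry

variable (d : ℕ) [NeZero d] {M : Type*} [TopologicalSpace M] [ChartedSpace (EuclideanHalfSpace d) M]
  {H : Type*} [NormedAddCommGroup H] [NormedSpace ℝ H]

/-- `ι : M → H` is a smooth embedding: a smooth topological embedding with injective differential. -/
structure IsEmbeddedManifold (ι : M → H) : Prop where
  smooth : ContMDiff (𝓡∂ d) 𝓘(ℝ, H) ((⊤ : ℕ∞) : WithTop ℕ∞) ι
  embedding : Topology.IsEmbedding ι
  immersion : ∀ z : M, Function.Injective (mfderiv (𝓡∂ d) 𝓘(ℝ, H) ι z)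

/-- The Riemannian distance on `M` of the metric induced by `ι` (the metric for which `ι` is
isometric): the infimum of the lengths of `C¹` paths, where a tangent vector `v` has length
`‖dι v‖`. It is `⊤` between different connected components. -/
def riemDist (ι : M → H) (x y : M) : ℝ≥0∞ :=
  letI : ∀ z : M, ENorm (TangentSpace (𝓡∂ d) z) :=
    fun z => ⟨fun v => ‖(show H from mfderiv (𝓡∂ d) 𝓘(ℝ, H) ι z v)‖ₑ⟩
  Manifold.riemannianEDist (𝓡∂ d) x y

/-- The boundary layer `M_h`: the points at Riemannian distance at most `h` from `∂M`. It is empty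
if `M` has no boundary. -/
def boundaryLayer (ι : M → H) (h : ℝ) : Set M :=
  {x | (⨅ y ∈ (𝓡∂ d).boundary M, riemDist d ι x y) ≤ ENNReal.ofReal h}

/-- The Riemannian volume measure of the metric induced by `ι`: the `d`-dimensional Hausdorff measure
of the ambient space (normalized to agree with Lebesgue measure on `ℝ^d`), pulled back to `M`. -/
def riemVol {H : Type*} [NormedAddCommGroup H] [MeasurableSpace H] [BorelSpace H]
    (d : ℕ) {M : Type*} [MeasurableSpace M] (ι : M → H) : Measure M :=
  Measure.comap ι (Measure.euclideanHausdorffMeasure d)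

/-- `g : M → ℝ` is twice differentiable with (locally) bounded second derivative, expressed in the
preferred charts; at boundary points of the half-space derivatives are taken within it. On a compact
manifold this is the same as being twice differentiable with bounded Hessian. -/
def TwiceDiffBounded (g : M → ℝ) : Prop :=
  ∀ x : M, ∃ B : ℝ, ∀ᶠ z in 𝓝[range (𝓡∂ d)] (extChartAt (𝓡∂ d) x x),
    DifferentiableWithinAt ℝ (g ∘ (extChartAt (𝓡∂ d) x).symm) (range (𝓡∂ d)) z ∧
    DifferentiableWithinAt ℝ
      (fderivWithin ℝ (g ∘ (extChartAt (𝓡∂ d) x).symm) (range (𝓡∂ d))) (range (𝓡∂ d)) z ∧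
    ‖fderivWithin ℝ (fderivWithin ℝ (g ∘ (extChartAt (𝓡∂ d) x).symm) (range (𝓡∂ d)))
      (range (𝓡∂ d)) z‖ ≤ B

end Geometry

/-! ### The estimator -/

section Estimator

variable {H : Type*} [NormedAddCommGroup H] [InnerProductSpace ℝ H] {n : ℕ}

/-- Indices of the observations within distance `h` of `x`. -/
def nbhd (h : ℝ) (x : H) (Xh : Fin n → H) : Finset (Fin n) :=
  {i | ‖x - Xh i‖ < h}

/-- The local mean. -/
def localMean (h : ℝ) (x : H) (Xh : Fin n → H) : H :=
  ((nbhd h x Xh).card : ℝ)⁻¹ • ∑ i ∈ nbhd h x Xh, Xh i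

/-- The local empirical covariance operator (the integral operator of the local empirical covariance
function when `H` is an `L²` space). -/
def localCov (h : ℝ) (x : H) (Xh : Fin n → H) (v : H) : H :=
  ((nbhd h x Xh).card : ℝ)⁻¹ •
    ∑ i ∈ nbhd h x Xh, inner ℝ (Xh i - localMean h x Xh) v • (Xh i - localMean h x Xh)

/-- `φ 0, …, φ (m - 1)` are orthonormal eigenvectors of `T` for its `m` largest eigenvalues, in
decreasing order: the `k`-th eigenvalue is the largest value of the quadratic form of `T` on unit
vectors orthogonal to the previous eigenvectors. -/
def IsTopEigenbasis (T : H → H) (m : ℕ) (φ : ℕ → H) : Prop :=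
  Orthonormal ℝ (fun k : Fin m => φ k) ∧
  ∃ ρ : ℕ → ℝ, ∀ k < m, T (φ k) = ρ k • φ k ∧
    ∀ v : H, (∀ j < k, inner ℝ (φ j) v = 0) → inner ℝ (T v) v ≤ ρ k * ‖v‖ ^ 2

/-- The design matrix: the `i`-th row is `1` followed by the coordinates of `Xh i - x` with respect
to `φ 0, …, φ (m - 1)`. -/
def designMatrix (x : H) (Xh : Fin n → H) (m : ℕ) (φ : ℕ → H) : Matrix (Fin n) (Fin (m + 1)) ℝ :=
  Matrix.of fun i => Fin.cons 1 fun k : Fin m => inner ℝ (Xh i - x) (φ k)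

/-- The diagonal weight matrix with entries `K_h(‖x - Xh i‖)`, `K_h(t) = K(t / h) / h ^ m`. -/
def weightMatrix (K : ℝ → ℝ) (h : ℝ) (x : H) (Xh : Fin n → H) (m : ℕ) :
    Matrix (Fin n) (Fin n) ℝ :=
  Matrix.diagonal fun i => K (‖x - Xh i‖ / h) / h ^ m

/-- The functional local linear manifold estimator at `x` in dimension `m`:
`e₁ᵀ (𝐗ᵀ 𝐖 𝐗)⁻¹ 𝐗ᵀ 𝐖 𝐘`. -/
def gHat (K : ℝ → ℝ) (h : ℝ) (x : H) (Xh : Fin n → H) (Y : Fin n → ℝ) (m : ℕ) (φ : ℕ → H) : ℝ :=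
  let A := designMatrix x Xh m φ
  let W := weightMatrix K h x Xh m
  Matrix.mulVec ((A.transpose * W * A)⁻¹ * A.transpose * W) Y 0

end Estimator

/-! ### Conditional mean squared error -/

/-- The joint vector `((X 1, Xhat 1), …, (X n, Xhat n))`. -/
def pairs {Ω M H : Type*} (X : ℕ → Ω → M) (Xhat : (n : ℕ) → Fin n → Ω → H) (n : ℕ) (ω : Ω) :
    Fin n → M × H :=
  fun i => (X i ω, Xhat n i ω)

/-- The σ-algebra generated by `(X 1, Xhat 1), …, (X n, Xhat n)`. -/
abbrev pairsSigma {Ω M H : Type*} [MeasurableSpace M] [MeasurableSpace H] (X : ℕ → Ω → M)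
    (Xhat : (n : ℕ) → Fin n → Ω → H) (n : ℕ) : MeasurableSpace Ω :=
  MeasurableSpace.comap (pairs X Xhat n) inferInstance

end FREM

end

namespace FREM

section Calculus

variable {E G : Type*} [NormedAddCommGroup E] [NormedSpace ℝ E] [NormedAddCommGroup G]
  [NormedSpace ℝ G]

/-- `F` has near `u₀` within `R` a derivative within `R` which is itself differentiable within `R`
with bounded derivative. -/
def LocallyTwiceDiff (F : E → G) (R : Set E) (u₀ : E) : Prop :=
  ∃ B : ℝ, ∀ᶠ z in 𝓝[R] u₀, DifferentiableWithinAt ℝ F R z ∧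
    DifferentiableWithinAt ℝ (fderivWithin ℝ F R) R z ∧
    ‖fderivWithin ℝ (fderivWithin ℝ F R) R z‖ ≤ B

/-- Quadratic control of `F` by its derivative on a set `V`. -/
structure QuadraticOn (F : E → G) (F' : E → E →L[ℝ] G) (B : ℝ) (V : Set E) : Prop where
  bound : ∀ u ∈ V, ‖F' u‖ ≤ B
  lip : ∀ u ∈ V, ∀ v ∈ V, ‖F' v - F' u‖ ≤ B * ‖v - u‖
  taylor : ∀ u ∈ V, ∀ v ∈ V, ‖F v - F u - F' u (v - u)‖ ≤ B * ‖v - u‖ ^ 2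

theorem QuadraticOn.mono {F : E → G} {F' : E → E →L[ℝ] G} {B B' : ℝ} {V V' : Set E}
    (h : QuadraticOn F F' B V) (hV : V' ⊆ V) (hB : B ≤ B') : QuadraticOn F F' B' V' where
  bound u hu := (h.bound u (hV hu)).trans hB
  lip u hu v hv := (h.lip u (hV hu) v (hV hv)).trans (by gcongr)
  taylor u hu v hv := (h.taylor u (hV hu) v (hV hv)).trans (by gcongr)

theorem LocallyTwiceDiff.exists_quadraticOn {F : E → G} {R : Set E} {u₀ : E}
    (h : LocallyTwiceDiff F R u₀) (hR : Convex ℝ R) (hu : u₀ ∈ R) :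
    ∃ B ρ : ℝ, 0 < B ∧ 0 < ρ ∧
      QuadraticOn F (fderivWithin ℝ F R) B (R ∩ Metric.ball u₀ ρ) := by
  obtain ⟨B, hB⟩ := h
  obtain ⟨ρ, hρ, hρB⟩ := Metric.mem_nhdsWithin_iff.1 hB
  have hsub : ∀ z ∈ R ∩ Metric.ball u₀ ρ, DifferentiableWithinAt ℝ F R z ∧
      DifferentiableWithinAt ℝ (fderivWithin ℝ F R) R z ∧
      ‖fderivWithin ℝ (fderivWithin ℝ F R) R z‖ ≤ B := fun z hz => hρB ⟨hz.2, hz.1⟩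
  set V := R ∩ Metric.ball u₀ ρ with hV
  have hVc : Convex ℝ V := hR.inter (convex_ball _ _)
  have hu₀ : u₀ ∈ V := ⟨hu, Metric.mem_ball_self hρ⟩
  have hB0 : 0 ≤ B := (norm_nonneg (fderivWithin ℝ (fderivWithin ℝ F R) R u₀)).trans (hsub u₀ hu₀).2.2
  have hlip : ∀ u ∈ V, ∀ v ∈ V,
      ‖fderivWithin ℝ F R v - fderivWithin ℝ F R u‖ ≤ B * ‖v - u‖ := fun u hu v hv =>
    Convex.norm_image_sub_le_of_norm_hasFDerivWithin_le
      (fun z hz => ((hsub z hz).2.1.hasFDerivWithinAt).mono inter_subset_left)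
      (fun z hz => (hsub z hz).2.2) hVc hu hv
  refine ⟨B + (‖fderivWithin ℝ F R u₀‖ + B * ρ) + 1, ρ, by positivity, hρ, ?_, ?_, ?_⟩
  · intro u hu
    have h1 := hlip u₀ hu₀ u hu
    have h2 : ‖u - u₀‖ ≤ ρ := (mem_ball_iff_norm.1 hu.2).le
    have h3 : ‖fderivWithin ℝ F R u‖ ≤ ‖fderivWithin ℝ F R u - fderivWithin ℝ F R u₀‖
      + ‖fderivWithin ℝ F R u₀‖ := norm_le_norm_sub_add _ _
    have h4 : B * ‖u - u₀‖ ≤ B * ρ := by gcongr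
    linarith
  · intro u hu v hv
    refine (hlip u hu v hv).trans ?_
    gcongr
    have := norm_nonneg (fderivWithin ℝ F R u₀)
    have : 0 ≤ B * ρ := by positivity
    linarith
  · intro u hu v hv
    have key : ‖F v - F u - fderivWithin ℝ F R u (v - u)‖ ≤ (B * ‖v - u‖) * ‖v - u‖ := by
      have hs : segment ℝ u v ⊆ V := hVc.segment_subset hu hv
      refine Convex.norm_image_sub_le_of_norm_hasFDerivWithin_le' (s := segment ℝ u v)
        (f' := fderivWithin ℝ F R)
        (fun z hz => ((hsub z (hs hz)).1.hasFDerivWithinAt).mono (hs.trans inter_subset_left))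
        (fun z hz => (hlip u hu z (hs hz)).trans ?_) (convex_segment u v)
        (left_mem_segment ℝ u v) (right_mem_segment ℝ u v)
      gcongr
      obtain ⟨a, b, ha, hb, hab, rfl⟩ := hz
      have : a • u + b • v - u = b • (v - u) := by
        rw [eq_sub_of_add_eq hab]; module
      rw [this, norm_smul, Real.norm_of_nonneg hb]
      exact mul_le_of_le_one_left (norm_nonneg _) (by linarith)
    refine key.trans ?_
    rw [mul_assoc, ← sq]
    gcongr
    have := norm_nonneg (fderivWithin ℝ F R u₀)
    have : 0 ≤ B * ρ := by positivity
    linarith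

theorem _root_.ContDiffWithinAt.locallyTwiceDiff {F : E → G} {R : Set E} {u₀ : E}
    (h : ContDiffWithinAt ℝ 2 F R u₀) (hR : UniqueDiffOn ℝ R) (hu : u₀ ∈ R) :
    LocallyTwiceDiff F R u₀ := by
  have h1 : ContDiffWithinAt ℝ 1 (fderivWithin ℝ F R) R u₀ :=
    h.fderivWithin_right hR (by norm_num) hu
  have h2 : ContDiffWithinAt ℝ 0 (fderivWithin ℝ (fderivWithin ℝ F R) R) R u₀ :=
    h1.fderivWithin_right hR (by norm_num) hu
  refine ⟨‖fderivWithin ℝ (fderivWithin ℝ F R) R u₀‖ + 1, ?_⟩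
  have e1 := h.eventually (by norm_num)
  have e2 := h1.eventually (by norm_num)
  rw [insert_eq_of_mem hu] at e1 e2
  have e3 := ((continuous_norm (E := E →L[ℝ] E →L[ℝ] G)).continuousAt.comp_continuousWithinAt
    h2.continuousWithinAt).eventually (eventually_lt_nhds (lt_add_one _))
  filter_upwards [e1, e2, e3] with z a b c
  exact ⟨a.differentiableWithinAt (by norm_num), b.differentiableWithinAt (by norm_num), c.le⟩

end Calculus

section Hausdorff

theorem _root_.LipschitzOnWith.euclideanHausdorffMeasure_image_le {X Y : Type*} [EMetricSpace X]
    [EMetricSpace Y] [MeasurableSpace X] [BorelSpace X] [MeasurableSpace Y] [BorelSpace Y]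
    {K : NNReal} {f : X → Y} {s : Set X} (h : LipschitzOnWith K f s) (d : ℕ) :
    Measure.euclideanHausdorffMeasure d (f '' s) ≤
      (K : ℝ≥0∞) ^ d * Measure.euclideanHausdorffMeasure d s := by
  have := h.hausdorffMeasure_image_le (d := d) (by positivity)
  rw [Measure.euclideanHausdorffMeasure_def, Measure.euclideanHausdorffMeasure_def,
    Measure.smul_apply, Measure.smul_apply, ENNReal.smul_def, ENNReal.smul_def, smul_eq_mul,
    smul_eq_mul, mul_left_comm]
  rw [ENNReal.rpow_natCast] at this
  gcongr

end Hausdorff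

section EuclideanPatch

variable {H : Type*} [NormedAddCommGroup H] [InnerProductSpace ℝ H]

theorem exists_patch {E G : Type*} [NormedAddCommGroup E] [NormedSpace ℝ E]
    [FiniteDimensional ℝ E] [NormedAddCommGroup G] [NormedSpace ℝ G] {F : E → H} {g : E → G}
    {R : Set E} {u₀ : E} (hR : Convex ℝ R) (hu : u₀ ∈ R)
    (hF : LocallyTwiceDiff F R u₀) (hg : LocallyTwiceDiff g R u₀)
    (hinj : Function.Injective (fderivWithin ℝ F R u₀)) {ρ' : ℝ} (hρ' : 0 < ρ') :
    ∃ ρ B m : ℝ, 0 < ρ ∧ ρ ≤ ρ' ∧ 0 < B ∧ 0 < m ∧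
      QuadraticOn F (fderivWithin ℝ F R) B (R ∩ Metric.ball u₀ ρ) ∧
      QuadraticOn g (fderivWithin ℝ g R) B (R ∩ Metric.ball u₀ ρ) ∧
      (∀ u ∈ R ∩ Metric.ball u₀ ρ, ∀ w, m * ‖w‖ ≤ ‖fderivWithin ℝ F R u w‖) ∧
      (∀ u ∈ R ∩ Metric.ball u₀ ρ, ∀ v ∈ R ∩ Metric.ball u₀ ρ,
        m * ‖v - u‖ ≤ ‖F v - F u‖ ∧ ‖F v - F u‖ ≤ B * ‖v - u‖) := by
  obtain ⟨B₁, ρ₁, hB₁, hρ₁, h₁⟩ := hF.exists_quadraticOn hR hu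
  obtain ⟨B₂, ρ₂, hB₂, hρ₂, h₂⟩ := hg.exists_quadraticOn hR hu
  obtain ⟨K, hK, hA⟩ := (fderivWithin ℝ F R u₀ : E →ₗ[ℝ] H).exists_antilipschitzWith
    (LinearMap.ker_eq_bot.2 hinj)
  set m₀ : ℝ := (K : ℝ)⁻¹ with hm₀
  have hm₀pos : 0 < m₀ := by positivity
  have hA' : ∀ w, m₀ * ‖w‖ ≤ ‖fderivWithin ℝ F R u₀ w‖ := by
    intro w
    have := hA.le_mul_dist w 0
    simp only [dist_zero_right, map_zero] at this
    rw [hm₀, inv_mul_le_iff₀ (by positivity)]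
    exact this
  set B := max B₁ B₂ with hB
  have hBpos : 0 < B := lt_max_of_lt_left hB₁
  set ρ := min (min ρ' (min ρ₁ ρ₂)) (min (1 / 2) (m₀ / (8 * B))) with hρ
  have hρpos : 0 < ρ := by rw [hρ]; positivity
  have hρ1 : ρ ≤ ρ₁ := (min_le_left _ _).trans ((min_le_right _ _).trans (min_le_left _ _))
  have hρ2 : ρ ≤ ρ₂ := (min_le_left _ _).trans ((min_le_right _ _).trans (min_le_right _ _))
  have hρ3 : ρ ≤ 1 / 2 := (min_le_right _ _).trans (min_le_left _ _)
  have hρ4 : B * ρ ≤ m₀ / 8 := by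
    have : ρ ≤ m₀ / (8 * B) := (min_le_right _ _).trans (min_le_right _ _)
    rw [le_div_iff₀ (by positivity)] at this
    linarith
  have hF2 : QuadraticOn F (fderivWithin ℝ F R) B (R ∩ Metric.ball u₀ ρ) :=
    h₁.mono (inter_subset_inter_right _ (Metric.ball_subset_ball hρ1)) (le_max_left _ _)
  have hg2 : QuadraticOn g (fderivWithin ℝ g R) B (R ∩ Metric.ball u₀ ρ) :=
    h₂.mono (inter_subset_inter_right _ (Metric.ball_subset_ball hρ2)) (le_max_right _ _)
  have hlow : ∀ u ∈ R ∩ Metric.ball u₀ ρ, ∀ w, m₀ / 2 * ‖w‖ ≤ ‖fderivWithin ℝ F R u w‖ := by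
    intro u hu' w
    have e1 := hF2.lip u₀ ⟨hu, Metric.mem_ball_self hρpos⟩ u hu'
    have e2 : ‖u - u₀‖ ≤ ρ := (mem_ball_iff_norm.1 hu'.2).le
    have e3 : ‖(fderivWithin ℝ F R u - fderivWithin ℝ F R u₀) w‖ ≤ m₀ / 8 * ‖w‖ := by
      refine (ContinuousLinearMap.le_opNorm _ _).trans ?_
      gcongr
      exact e1.trans ((mul_le_mul_of_nonneg_left e2 hBpos.le).trans hρ4)
    have e4 := hA' w
    rw [sub_apply] at e3
    have e5 := norm_sub_norm_le (fderivWithin ℝ F R u₀ w) (fderivWithin ℝ F R u w)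
    rw [norm_sub_rev] at e5
    have : 0 ≤ m₀ * ‖w‖ := by positivity
    linarith
  refine ⟨ρ, 2 * B, m₀ / 4, hρpos, (min_le_left _ _).trans (min_le_left _ _), by positivity,
    by positivity, hF2.mono subset_rfl (by linarith), hg2.mono subset_rfl (by linarith), ?_, ?_⟩
  · intro u hu w
    refine le_trans ?_ (hlow u hu w)
    gcongr
    linarith
  · intro u hu v hv
    have e1 := hF2.taylor u hu v hv
    have e2 := hlow u hu (v - u)
    have e3 : ‖fderivWithin ℝ F R u (v - u)‖ ≤ B * ‖v - u‖ :=
      ContinuousLinearMap.le_of_opNorm_le _ (hF2.bound u hu) _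
    have e4 : ‖v - u‖ ≤ 2 * ρ := by
      have a1 := mem_ball_iff_norm.1 hu.2
      have a2 := mem_ball_iff_norm.1 hv.2
      have a3 : v - u = (v - u₀) - (u - u₀) := by abel
      rw [a3]
      exact (norm_sub_le _ _).trans (by linarith)
    have e5 : B * ‖v - u‖ ^ 2 ≤ m₀ / 4 * ‖v - u‖ := by
      rw [sq, ← mul_assoc]
      gcongr
      calc B * ‖v - u‖ ≤ B * (2 * ρ) := by gcongr
        _ ≤ m₀ / 4 := by linarith
    have e6 : B * ‖v - u‖ ^ 2 ≤ B * ‖v - u‖ := by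
      gcongr
      rw [sq]
      exact mul_le_of_le_one_left (norm_nonneg _) (by linarith)
    have a1 := norm_sub_norm_le (fderivWithin ℝ F R u (v - u)) (F v - F u)
    rw [norm_sub_rev _ (F v - F u)] at a1
    have a2 := norm_sub_norm_le (F v - F u) (fderivWithin ℝ F R u (v - u))
    constructor <;> linarith

/-- Affine functionals are controlled by their values at two points on each of the `d` axes. -/
theorem affine_le_of_axis_values {d : ℕ} [NeZero d] (A : EuclideanSpace ℝ (Fin d) →L[ℝ] H)
    {m B ra rb h q a : ℝ} (hm : 0 < m) (hAm : ∀ w, m * ‖w‖ ≤ ‖A w‖) (hAB : ‖A‖ ≤ B)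
    (hra : 0 < ra) (hab : ra < rb) (hh : 0 < h) (w : EuclideanSpace ℝ (Fin d))
    (h₁ : ∀ k, |a + inner ℝ (A w) (A ((ra * h / ‖A (EuclideanSpace.single k 1)‖) •
      EuclideanSpace.single k 1))| ≤ q)
    (h₂ : ∀ k, |a + inner ℝ (A w) (A ((rb * h / ‖A (EuclideanSpace.single k 1)‖) •
      EuclideanSpace.single k 1))| ≤ q) :
    |a| + h * ‖A w‖ ≤ (1 + 2 * rb / (rb - ra) + 2 * d * B / (m * (rb - ra))) * q := by
  have hδ : 0 < rb - ra := by linarith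
  have hB : 0 ≤ B := (norm_nonneg _).trans hAB
  have hpos : ∀ k, 0 < ‖A (EuclideanSpace.single k (1 : ℝ))‖ := fun k => by
    have := hAm (EuclideanSpace.single k (1 : ℝ))
    rw [PiLp.norm_single] at this
    simp only [norm_one, mul_one] at this
    linarith
  set b : Fin d → ℝ := fun k => h * inner ℝ (A w) (A (EuclideanSpace.single k (1 : ℝ))) /
    ‖A (EuclideanSpace.single k (1 : ℝ))‖ with hb
  have e : ∀ r k, inner ℝ (A w) (A ((r * h / ‖A (EuclideanSpace.single k (1 : ℝ))‖) •
      EuclideanSpace.single k (1 : ℝ))) = r * b k := by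
    intro r k
    rw [map_smul, inner_smul_right, hb]
    ring
  simp only [e] at h₁ h₂
  have hbk : ∀ k, |b k| ≤ 2 * q / (rb - ra) := by
    intro k
    rw [le_div_iff₀ hδ, ← abs_of_pos hδ, ← abs_mul]
    have : b k * (rb - ra) = (a + rb * b k) - (a + ra * b k) := by ring
    rw [this]
    exact (abs_sub _ _).trans (by linarith [h₁ k, h₂ k])
  have hq : 0 ≤ q := (abs_nonneg _).trans (h₁ 0)
  have ha : |a| ≤ q + rb * (2 * q / (rb - ra)) := by
    have : a = (a + rb * b 0) - rb * b 0 := by ring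
    rw [this]
    refine (abs_sub _ _).trans (add_le_add (h₂ 0) ?_)
    rw [abs_mul, abs_of_pos (by linarith : 0 < rb)]
    exact mul_le_mul_of_nonneg_left (hbk 0) (by linarith)
  have hw : A w = ∑ k, w k • A (EuclideanSpace.single k (1 : ℝ)) := by
    conv_lhs => rw [← (EuclideanSpace.basisFun (Fin d) ℝ).sum_repr w]
    simp
  have hv : h * ‖A w‖ ≤ 2 * d * B / (m * (rb - ra)) * q := by
    rcases (norm_nonneg (A w)).eq_or_lt with h0 | h0
    · rw [← h0, mul_zero]; positivity
    have key : h * ‖A w‖ ^ 2 ≤ d * (‖A w‖ / m * (B * (2 * q / (rb - ra)))) := by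
      have : h * ‖A w‖ ^ 2 = ∑ k, w k * (‖A (EuclideanSpace.single k (1 : ℝ))‖ * b k) := by
        rw [← real_inner_self_eq_norm_sq]
        nth_rewrite 2 [hw]
        rw [inner_sum, Finset.mul_sum]
        refine Finset.sum_congr rfl fun k _ => ?_
        rw [inner_smul_right, hb]
        have := (hpos k).ne'
        field_simp
      rw [this]
      have hk : ∀ k ∈ Finset.univ, w k * (‖A (EuclideanSpace.single k (1 : ℝ))‖ * b k) ≤
          ‖A w‖ / m * (B * (2 * q / (rb - ra))) := by
        intro k _
        refine (le_abs_self _).trans ?_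
        rw [abs_mul, abs_mul, abs_norm]
        have a1 : |w k| ≤ ‖A w‖ / m := by
          rw [le_div_iff₀ hm, mul_comm]
          refine le_trans ?_ (hAm w)
          gcongr
          exact PiLp.norm_apply_le w k
        have a2 : ‖A (EuclideanSpace.single k (1 : ℝ))‖ ≤ B := by
          refine (ContinuousLinearMap.le_of_opNorm_le _ hAB _).trans ?_
          rw [PiLp.norm_single]; simp
        have := hbk k
        gcongr
      refine (Finset.sum_le_sum hk).trans ?_
      simp
    have : h * ‖A w‖ * ‖A w‖ ≤ (2 * d * B / (m * (rb - ra)) * q) * ‖A w‖ := by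
      calc h * ‖A w‖ * ‖A w‖ = h * ‖A w‖ ^ 2 := by ring
        _ ≤ _ := key
        _ = _ := by field_simp
    exact le_of_mul_le_mul_right this h0
  calc |a| + h * ‖A w‖ ≤ (q + rb * (2 * q / (rb - ra))) + 2 * d * B / (m * (rb - ra)) * q :=
        add_le_add ha hv
    _ = _ := by ring

theorem exists_cells {d : ℕ} [NeZero d] {F : EuclideanSpace ℝ (Fin d) → H}
    {A : EuclideanSpace ℝ (Fin d) → EuclideanSpace ℝ (Fin d) →L[ℝ] H}
    {u₀ : EuclideanSpace ℝ (Fin d)} {ρ B m r₁ r₂ : ℝ} (hρ : 0 < ρ) (hB : 0 < B) (hm : 0 < m)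
    (hr₁ : 0 < r₁) (hr : r₁ < r₂)
    (hF : QuadraticOn F A B ({y | 0 ≤ y 0} ∩ Metric.ball u₀ ρ))
    (hA : ∀ u ∈ {y : EuclideanSpace ℝ (Fin d) | 0 ≤ y 0} ∩ Metric.ball u₀ ρ,
      ∀ w, m * ‖w‖ ≤ ‖A u w‖) :
    ∃ c κ h₀ : ℝ, 0 < c ∧ 0 < κ ∧ 0 < h₀ ∧
      ∀ u ∈ {y : EuclideanSpace ℝ (Fin d) | 0 ≤ y 0} ∩ Metric.ball u₀ (ρ / 2),
      ∀ h, 0 < h → h < h₀ → ∃ p : Fin d × Bool → EuclideanSpace ℝ (Fin d),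
        (∀ j, Metric.ball (p j) (κ * h) ⊆ {y | 0 ≤ y 0} ∩ Metric.ball u₀ ρ) ∧
        (∀ j, ∀ y ∈ Metric.ball (p j) (κ * h), r₁ * h ≤ ‖F y - F u‖ ∧ ‖F y - F u‖ ≤ r₂ * h) ∧
        ∀ (a : ℝ) (w : EuclideanSpace ℝ (Fin d)), ∃ j, ∀ y ∈ Metric.ball (p j) (κ * h),
          c * (|a| + h * ‖A u w‖) ≤ |a + inner ℝ (A u w) (F y - F u)| := by
  set δ := (r₂ - r₁) / 3 with hδ
  have hδ0 : 0 < δ := by rw [hδ]; linarith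
  set ra := r₁ + δ with hra
  set rb := r₁ + 2 * δ with hrb
  have hr2 : r₂ = r₁ + 3 * δ := by rw [hδ]; ring
  set C₁ := 1 + 2 * rb / (rb - ra) + 2 * d * B / (m * (rb - ra)) with hC₁
  have hδ' : rb - ra = δ := by rw [hra, hrb]; ring
  have hC₁pos : 0 < C₁ := by rw [hC₁, hδ']; positivity
  set κ := min 1 (min (δ / (3 * B)) (1 / (12 * B * C₁))) with hκ
  have hκ0 : 0 < κ := by rw [hκ]; positivity
  have hκ1 : κ ≤ 1 := min_le_left _ _
  have hκ2 : 3 * B * κ ≤ δ := by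
    have : κ ≤ δ / (3 * B) := (min_le_right _ _).trans (min_le_left _ _)
    rw [le_div_iff₀ (by positivity)] at this
    linarith
  have hκ3 : C₁ * (3 * B * κ) ≤ 1 / 4 := by
    have : κ ≤ 1 / (12 * B * C₁) := (min_le_right _ _).trans (min_le_right _ _)
    rw [le_div_iff₀ (by positivity)] at this
    linarith
  set c₃ := r₂ / m + 2 with hc₃
  have hc₃0 : 0 < c₃ := by rw [hc₃]; have : 0 < r₂ := by linarith
                           positivity
  refine ⟨1 / (4 * C₁), κ, min (ρ / (2 * c₃)) (κ / c₃ ^ 2), by positivity, hκ0, by positivity, ?_⟩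
  intro u hu h hh hlt
  have hh1 : c₃ * h < ρ / 2 := by
    have : h < ρ / (2 * c₃) := hlt.trans_le (min_le_left _ _)
    rw [lt_div_iff₀ (by positivity)] at this
    linarith
  have hh2 : c₃ ^ 2 * h ≤ κ := by
    have : h ≤ κ / c₃ ^ 2 := hlt.le.trans (min_le_right _ _)
    rw [le_div_iff₀ (by positivity)] at this
    linarith
  have huV : u ∈ {y : EuclideanSpace ℝ (Fin d) | 0 ≤ y 0} ∩ Metric.ball u₀ ρ :=
    ⟨hu.1, Metric.ball_subset_ball (by linarith) hu.2⟩
  have hAu := hA u huV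
  have hpos : ∀ k, m ≤ ‖A u (EuclideanSpace.single k (1 : ℝ))‖ := fun k => by
    have := hAu (EuclideanSpace.single k (1 : ℝ))
    rw [PiLp.norm_single] at this
    simpa using this
  set r : Bool → ℝ := fun b => if b then rb else ra with hrdef
  have hrr : ∀ b, r₁ + δ ≤ r b ∧ r b ≤ r₁ + 2 * δ := by
    intro b; cases b <;> simp [hrdef, hra, hrb] <;> linarith
  set s : Fin d × Bool → EuclideanSpace ℝ (Fin d) := fun j =>
    (r j.2 * h / ‖A u (EuclideanSpace.single j.1 (1 : ℝ))‖) • EuclideanSpace.single j.1 (1 : ℝ)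
    with hs
  have hsc : ∀ j : Fin d × Bool, 0 < r j.2 * h / ‖A u (EuclideanSpace.single j.1 (1 : ℝ))‖ := by
    intro j
    have := hpos j.1
    have := (hrr j.2).1
    have : 0 < r j.2 := by linarith
    have : 0 < ‖A u (EuclideanSpace.single j.1 (1 : ℝ))‖ := by linarith
    positivity
  have hAs : ∀ j, ‖A u (s j)‖ = r j.2 * h := by
    intro j
    have h1 : 0 < ‖A u (EuclideanSpace.single j.1 (1 : ℝ))‖ := lt_of_lt_of_le hm (hpos j.1)
    rw [hs]
    simp only [map_smul]
    rw [norm_smul, Real.norm_of_nonneg (hsc j).le]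
    field_simp
  have hsn : ∀ j, ‖s j‖ ≤ r₂ * h / m := by
    intro j
    rw [le_div_iff₀ hm, mul_comm]
    refine (hAu (s j)).trans ?_
    rw [hAs]
    gcongr
    linarith [(hrr j.2).2]
  have hs0 : ∀ j, 0 ≤ (s j) 0 := by
    intro j
    rw [hs]
    simp only [PiLp.smul_apply, smul_eq_mul]
    refine mul_nonneg (hsc j).le ?_
    rw [PiLp.single_apply]
    split_ifs <;> norm_num
  set p : Fin d × Bool → EuclideanSpace ℝ (Fin d) := fun j =>
    u + s j + (κ * h) • EuclideanSpace.single 0 (1 : ℝ) with hp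
  have hκh : 0 < κ * h := by positivity
  have hys : ∀ j, ∀ y ∈ Metric.ball (p j) (κ * h), ‖y - u - s j‖ ≤ 2 * κ * h := by
    intro j y hy
    have h1 := mem_ball_iff_norm.1 hy
    have : y - u - s j = (y - p j) + (κ * h) • EuclideanSpace.single 0 (1 : ℝ) := by
      rw [hp]; module
    rw [this]
    refine (norm_add_le _ _).trans ?_
    rw [norm_smul, PiLp.norm_single, Real.norm_of_nonneg hκh.le]
    simp only [norm_one, mul_one]
    linarith
  have hyu : ∀ j, ∀ y ∈ Metric.ball (p j) (κ * h), ‖y - u‖ ≤ c₃ * h := by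
    intro j y hy
    have : y - u = (y - u - s j) + s j := by abel
    rw [this]
    refine (norm_add_le _ _).trans ((add_le_add (hys j y hy) (hsn j)).trans ?_)
    rw [hc₃, add_mul, add_comm, div_mul_eq_mul_div]
    gcongr
    linarith
  have hsub : ∀ j, Metric.ball (p j) (κ * h) ⊆ {y | 0 ≤ y 0} ∩ Metric.ball u₀ ρ := by
    intro j y hy
    constructor
    · have h1 : |(y - p j) 0| ≤ ‖y - p j‖ := PiLp.norm_apply_le (y - p j) 0
      have h2 := mem_ball_iff_norm.1 hy
      have h3 : (p j) 0 = u 0 + s j 0 + κ * h := by simp [hp]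
      have h4 := (abs_le.1 h1).1
      rw [PiLp.sub_apply, h3] at h4
      have h5 : 0 ≤ u 0 := hu.1
      have h6 := hs0 j
      change 0 ≤ y 0
      linarith
    · rw [mem_ball_iff_norm]
      have : y - u₀ = (y - u) + (u - u₀) := by abel
      rw [this]
      have h1 := mem_ball_iff_norm.1 hu.2
      exact (norm_add_le _ _).trans_lt (by linarith [hyu j y hy])
  have herr : ∀ j, ∀ y ∈ Metric.ball (p j) (κ * h),
      ‖F y - F u - A u (s j)‖ ≤ 3 * B * κ * h := by
    intro j y hy
    have h1 := hF.taylor u huV y (hsub j hy)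
    have h2 : ‖A u (y - u - s j)‖ ≤ B * (2 * κ * h) :=
      ContinuousLinearMap.le_of_opNorm_le_of_le _ (hF.bound u huV) (hys j y hy)
    have h3 : F y - F u - A u (s j) = (F y - F u - A u (y - u)) + A u (y - u - s j) := by
      rw [map_sub (A u) (y - u) (s j)]; abel
    rw [h3]
    refine (norm_add_le _ _).trans ((add_le_add h1 h2).trans ?_)
    have h4 : ‖y - u‖ ^ 2 ≤ κ * h := by
      calc ‖y - u‖ ^ 2 ≤ (c₃ * h) ^ 2 := by gcongr; exact hyu j y hy
        _ = (c₃ ^ 2 * h) * h := by ring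
        _ ≤ κ * h := by gcongr
    have h5 : B * ‖y - u‖ ^ 2 ≤ B * (κ * h) := by gcongr
    linarith
  refine ⟨p, hsub, ?_, ?_⟩
  · intro j y hy
    have h1 := herr j y hy
    have h2 := norm_sub_norm_le (F y - F u) (A u (s j))
    have h3 := norm_sub_norm_le (A u (s j)) (F y - F u)
    rw [norm_sub_rev _ (F y - F u)] at h3
    rw [hAs] at h2 h3
    have h4 : 3 * B * κ * h ≤ δ * h := by gcongr
    have h5 : (r₁ + δ) * h ≤ r j.2 * h := by gcongr; exact (hrr _).1
    have h6 : r j.2 * h ≤ (r₁ + 2 * δ) * h := by gcongr; exact (hrr _).2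
    constructor
    · linarith
    · rw [hr2]; linarith
  · intro a w
    by_contra! hcon
    choose y hy hlt' using hcon
    set Q := |a| + h * ‖A u w‖ with hQ
    have hQ0 : 0 ≤ Q := by positivity
    set q := 1 / (4 * C₁) * Q + 3 * B * κ * Q with hq
    have hval : ∀ j, |a + inner ℝ (A u w) (A u (s j))| ≤ q := by
      intro j
      have h1 : a + inner ℝ (A u w) (A u (s j)) = (a + inner ℝ (A u w) (F (y j) - F u)) -
          inner ℝ (A u w) (F (y j) - F u - A u (s j)) := by
        rw [inner_sub_right (A u w) (F (y j) - F u)]; ring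
      rw [h1]
      refine (abs_sub _ _).trans (add_le_add (hlt' j).le ?_)
      refine (abs_real_inner_le_norm _ _).trans ?_
      calc ‖A u w‖ * ‖F (y j) - F u - A u (s j)‖ ≤ ‖A u w‖ * (3 * B * κ * h) := by
            gcongr; exact herr j _ (hy j)
        _ = 3 * B * κ * (h * ‖A u w‖) := by ring
        _ ≤ 3 * B * κ * Q := by gcongr; rw [hQ]; linarith [abs_nonneg a]
    have hmain : Q ≤ C₁ * q := by
      refine affine_le_of_axis_values (A u) hm hAu (hF.bound u huV) (by linarith) (by linarith) hh w
        (fun k => ?_) (fun k => ?_)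
      · simpa [hs, hrdef] using hval (k, false)
      · simpa [hs, hrdef] using hval (k, true)
    have h2 : C₁ * q ≤ Q / 2 := by
      have : C₁ * q = Q / 4 + C₁ * (3 * B * κ) * Q := by rw [hq]; field_simp
      rw [this]
      have : C₁ * (3 * B * κ) * Q ≤ 1 / 4 * Q := by gcongr
      linarith
    have hQz : Q = 0 := by linarith
    have := hlt' (0, true)
    rw [hQz, mul_zero] at this
    exact absurd this (not_lt.2 (abs_nonneg _))

end EuclideanPatch

section Manifold

theorem exists_riesz_of_antilipschitz {E H : Type*} [NormedAddCommGroup E] [NormedSpace ℝ E]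
    [FiniteDimensional ℝ E] [NormedAddCommGroup H] [InnerProductSpace ℝ H] (A : E →L[ℝ] H)
    (L : E →L[ℝ] ℝ) {m B : ℝ} (hm : 0 < m) (hA : ∀ w, m * ‖w‖ ≤ ‖A w‖) (hL : ‖L‖ ≤ B) :
    ∃ γ ∈ (A : E →ₗ[ℝ] H).range, (∀ w, inner ℝ γ (A w) = L w) ∧ ‖γ‖ ≤ B / m := by
  set Φ : E →ₗ[ℝ] E →ₗ[ℝ] ℝ := (innerₗ H).compl₁₂ (A : E →ₗ[ℝ] H) (A : E →ₗ[ℝ] H) with hΦ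
  have hΦa : ∀ w w', Φ w w' = inner ℝ (A w) (A w') := fun w w' => rfl
  have hinj : Function.Injective Φ := by
    rw [injective_iff_map_eq_zero]
    intro w hw
    have h1 : Φ w w = 0 := by rw [hw]; rfl
    rw [hΦa, inner_self_eq_zero] at h1
    have h2 := hA w
    rw [h1, norm_zero] at h2
    exact norm_le_zero_iff.1 (by nlinarith [norm_nonneg w])
  have hsurj : Function.Surjective Φ :=
    (LinearMap.injective_iff_surjective_of_finrank_eq_finrank
      (Subspace.dual_finrank_eq (K := ℝ) (V := E)).symm).1 hinj
  obtain ⟨w, hw⟩ := hsurj (L : E →ₗ[ℝ] ℝ)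
  have hw' : ∀ w', inner ℝ (A w) (A w') = L w' := fun w' => by
    rw [← hΦa, hw]; rfl
  refine ⟨A w, ⟨w, rfl⟩, hw', ?_⟩
  have hB : 0 ≤ B := (norm_nonneg _).trans hL
  rcases (norm_nonneg (A w)).eq_or_lt with h0 | h0
  · rw [← h0]; positivity
  · rw [le_div_iff₀ hm]
    refine le_of_mul_le_mul_right ?_ h0
    calc ‖A w‖ * m * ‖A w‖ = m * inner ℝ (A w) (A w) := by
          rw [real_inner_self_eq_norm_sq]; ring
      _ = m * L w := by rw [hw']
      _ ≤ m * (B * ‖w‖) := by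
          gcongr
          exact (le_abs_self _).trans (ContinuousLinearMap.le_of_opNorm_le L hL w)
      _ = B * (m * ‖w‖) := by ring
      _ ≤ B * ‖A w‖ := by gcongr; exact hA w

/-- Quantitative local geometry at `x` of a `d`-dimensional embedded set with volume measure `ν`:
the tangent space `T`, the gradient `γ` of `g`, and sets of directions which make affine functions
on the tangent space bounded below. -/
structure LocalGeometry {M H : Type*} [MeasurableSpace M] [NormedAddCommGroup H]
    [InnerProductSpace ℝ H] (d : ℕ) (ι : M → H) (ν : Measure M) (g : M → ℝ) (r₁ r₂ c C h₀ : ℝ)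
    (x : M) (T : Submodule ℝ H) (γ : H) : Prop where
  finrank_eq : Module.finrank ℝ T = d
  mem : γ ∈ T
  norm_le : ‖γ‖ ≤ C
  tangent : ∀ y, ‖ι y - ι x‖ < h₀ → ∃ t ∈ T, ‖ι y - ι x - t‖ ≤ C * ‖ι y - ι x‖ ^ 2 ∧
    |g y - g x - inner ℝ γ t| ≤ C * ‖ι y - ι x‖ ^ 2
  vol_le : ∀ h, 0 < h → h < h₀ → ν {y | ‖ι y - ι x‖ ≤ h} ≤ ENNReal.ofReal (C * h ^ d)
  cells : ∀ h, 0 < h → h < h₀ → ∃ S : Fin d × Bool → Set M, (∀ j, MeasurableSet (S j)) ∧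
    (∀ j, ENNReal.ofReal (c * h ^ d) ≤ ν (S j)) ∧
    (∀ j, ∀ y ∈ S j, r₁ * h ≤ ‖ι y - ι x‖ ∧ ‖ι y - ι x‖ ≤ r₂ * h) ∧
    ∀ (a : ℝ), ∀ v ∈ T, ∃ j, ∀ y ∈ S j,
      c * (|a| + h * ‖v‖) ≤ |a + inner ℝ v (ι y - ι x)|

theorem LocalGeometry.mono {M H : Type*} [MeasurableSpace M] [NormedAddCommGroup H]
    [InnerProductSpace ℝ H] {d : ℕ} {ι : M → H} {ν : Measure M} {g : M → ℝ}
    {r₁ r₂ c C h₀ c' C' h₀' : ℝ} {x : M} {T : Submodule ℝ H} {γ : H}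
    (hx : LocalGeometry d ι ν g r₁ r₂ c C h₀ x T γ) (hc : c' ≤ c) (hC : C ≤ C') (hh : h₀' ≤ h₀) :
    LocalGeometry d ι ν g r₁ r₂ c' C' h₀' x T γ where
  finrank_eq := hx.finrank_eq
  mem := hx.mem
  norm_le := hx.norm_le.trans hC
  tangent y hy := by
    obtain ⟨t, ht, h1, h2⟩ := hx.tangent y (hy.trans_le hh)
    exact ⟨t, ht, h1.trans (by gcongr), h2.trans (by gcongr)⟩
  vol_le h h0 h1 := (hx.vol_le h h0 (h1.trans_le hh)).trans (by gcongr)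
  cells h h0 h1 := by
    obtain ⟨S, s1, s2, s3, s4⟩ := hx.cells h h0 (h1.trans_le hh)
    refine ⟨S, s1, fun j => le_trans (by gcongr) (s2 j), s3, fun a v hv => ?_⟩
    obtain ⟨j, hj⟩ := s4 a v hv
    exact ⟨j, fun y hy => le_trans (by gcongr) (hj y hy)⟩

variable {d : ℕ} [NeZero d] {M : Type*} [TopologicalSpace M]
  [ChartedSpace (EuclideanHalfSpace d) M] [MeasurableSpace M] [BorelSpace M]
  {H : Type*} [NormedAddCommGroup H] [InnerProductSpace ℝ H] [MeasurableSpace H] [BorelSpace H]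

theorem volume_ball_euclidean (p : EuclideanSpace ℝ (Fin d)) {r : ℝ} (hr : 0 ≤ r) :
    Measure.euclideanHausdorffMeasure d (Metric.ball p r) =
      ENNReal.ofReal (r ^ d * (volume (Metric.ball (0 : EuclideanSpace ℝ (Fin d)) 1)).toReal) := by
  have : Nontrivial (EuclideanSpace ℝ (Fin d)) :=
    Module.nontrivial_of_finrank_pos (R := ℝ)
      (by rw [finrank_euclideanSpace_fin]; exact NeZero.pos d)
  rw [EuclideanSpace.euclideanHausdorffMeasure_eq_volume, Measure.addHaar_ball _ _ hr,
    finrank_euclideanSpace_fin, ENNReal.ofReal_mul (by positivity),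
    ENNReal.ofReal_toReal measure_ball_lt_top.ne]

theorem IsEmbeddedManifold.exists_nhds_localGeometry [IsManifold (𝓡∂ d) ((⊤ : ℕ∞) : WithTop ℕ∞) M]
    [CompactSpace M] {ι : M → H} (hι : IsEmbeddedManifold d ι) {g : M → ℝ}
    (hg : TwiceDiffBounded d g) {r₁ r₂ : ℝ} (hr₁ : 0 < r₁) (hr : r₁ < r₂) (x₀ : M) :
    ∃ U ∈ 𝓝 x₀, ∃ c C h₀ : ℝ, 0 < c ∧ 0 < C ∧ 0 < h₀ ∧ ∀ x ∈ U, ∃ T γ,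
      LocalGeometry d ι (riemVol d ι) g r₁ r₂ c C h₀ x T γ := by
  set e := extChartAt (𝓡∂ d) x₀ with he
  set R : Set (EuclideanSpace ℝ (Fin d)) := range (𝓡∂ d) with hRdef
  have hRe : R = {y | 0 ≤ y 0} := range_modelWithCornersEuclideanHalfSpace d
  set F : EuclideanSpace ℝ (Fin d) → H := ι ∘ e.symm with hF
  set u₀ := e x₀ with hu₀
  have hu₀R : u₀ ∈ R := mem_range_self _
  have hRc : Convex ℝ R := (𝓡∂ d).convex_range
  have hcont : Continuous ι := hι.smooth.continuous
  have hFs : LocallyTwiceDiff F R u₀ := by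
    have h1 := (contMDiffAt_iff.1 (hι.smooth x₀)).2
    have h2 : ContDiffWithinAt ℝ ((⊤ : ℕ∞) : WithTop ℕ∞) F R u₀ := h1
    exact (h2.of_le (WithTop.coe_le_coe.2 (le_top : (2 : ℕ∞) ≤ ⊤))).locallyTwiceDiff (𝓡∂ d).uniqueDiffOn hu₀R
  have hgs : LocallyTwiceDiff (g ∘ e.symm) R u₀ := hg x₀
  have hinj : Function.Injective (fderivWithin ℝ F R u₀) := by
    have h1 := hι.immersion x₀
    rw [(hι.smooth.mdifferentiable (by simp) x₀).mfderiv] at h1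
    exact h1
  obtain ⟨ρ', hρ', hsub⟩ := Metric.mem_nhdsWithin_iff.1
    (extChartAt_target_mem_nhdsWithin (I := 𝓡∂ d) x₀)
  obtain ⟨ρ, B, m, hρ, hρρ', hB, hm, hqF, hqg, hA, hbi⟩ :=
    exists_patch hRc hu₀R hFs hgs hinj hρ'
  set V := R ∩ Metric.ball u₀ ρ with hV
  have hVt : V ⊆ e.target := fun y hy => hsub ⟨Metric.ball_subset_ball hρρ' hy.2, hy.1⟩
  obtain ⟨c, κ, h₁, hc, hκ, hh₁, hcells⟩ := exists_cells (F := F) (A := fderivWithin ℝ F R)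
    (u₀ := u₀) hρ hB hm hr₁ hr (by rw [← hRe]; exact hqF) (by rw [← hRe]; exact hA)
  rw [← hRe] at hcells
  have hW : ∀ r, 0 < r → e.source ∩ e ⁻¹' Metric.ball u₀ r ∈ 𝓝 x₀ := by
    intro r hr
    rw [he, extChartAt_source]
    exact (isOpen_extChartAt_preimage x₀ Metric.isOpen_ball).mem_nhds
      ⟨mem_chart_source _ _, Metric.mem_ball_self hr⟩
  have hη : ∃ η, 0 < η ∧ ∀ y, ‖ι y - ι x₀‖ < η → y ∈ e.source ∩ e ⁻¹' Metric.ball u₀ ρ := by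
    have h1 := hW ρ hρ
    rw [hι.embedding.isInducing.nhds_eq_comap, mem_comap] at h1
    obtain ⟨N, hN, hNs⟩ := h1
    obtain ⟨η, hη, hηN⟩ := Metric.mem_nhds_iff.1 hN
    exact ⟨η, hη, fun y hy => hNs (hηN (mem_ball_iff_norm.2 hy))⟩
  obtain ⟨η, hη, hηW⟩ := hη
  set U : Set M := (e.source ∩ e ⁻¹' Metric.ball u₀ (ρ / 2)) ∩ {x | ‖ι x - ι x₀‖ < η / 2} with hU
  have hUn : U ∈ 𝓝 x₀ := by
    refine inter_mem (hW _ (by linarith)) ?_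
    refine (isOpen_lt (by fun_prop) continuous_const).mem_nhds ?_
    simp only [mem_ofPred_eq, sub_self, norm_zero]
    linarith
  have hmemb : MeasurableEmbedding ι := by
    have : T2Space M := hι.embedding.t2Space
    exact (hcont.isClosedEmbedding hι.embedding.injective).measurableEmbedding
  set ω := (volume (Metric.ball (0 : EuclideanSpace ℝ (Fin d)) 1)).toReal with hω
  have hω0 : 0 < ω := ENNReal.toReal_pos (Metric.measure_ball_pos _ _ one_pos).ne'
    measure_ball_lt_top.ne
  have hFy : ∀ y ∈ e.source, F (e y) = ι y := fun y hy => by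
    rw [hF, Function.comp_apply, e.left_inv hy]
  have hgy : ∀ y ∈ e.source, (g ∘ e.symm) (e y) = g y := fun y hy => by
    rw [Function.comp_apply, e.left_inv hy]
  have heR : ∀ y, e y ∈ R := fun y => mem_range_self _
  set C := max (B / m) (max (B / m ^ 2) (B ^ d * ((2 / m) ^ d * ω))) with hC
  have hC1 : B / m ≤ C := le_max_left _ _
  have hC2 : B / m ^ 2 ≤ C := (le_max_left _ _).trans (le_max_right _ _)
  have hC3 : B ^ d * ((2 / m) ^ d * ω) ≤ C := (le_max_right _ _).trans (le_max_right _ _)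
  have hC0 : 0 < C := lt_of_lt_of_le (by positivity) hC1
  set c' := min c ((m * κ) ^ d * ω) with hc'
  have hc'0 : 0 < c' := by rw [hc']; positivity
  refine ⟨U, hUn, c', C, min h₁ (η / 2), hc'0, hC0, by positivity, ?_⟩
  rintro x ⟨⟨hxs, hxb⟩, hxη⟩
  set u := e x with hu
  have huV : u ∈ V := ⟨heR x, Metric.ball_subset_ball (by linarith) hxb⟩
  have hnear : ∀ y, ‖ι y - ι x‖ < min h₁ (η / 2) → y ∈ e.source ∧ e y ∈ V := by
    intro y hy
    have h1 : y ∈ e.source ∩ e ⁻¹' Metric.ball u₀ ρ := by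
      refine hηW y ?_
      have : ι y - ι x₀ = (ι y - ι x) + (ι x - ι x₀) := by abel
      rw [this]
      refine (norm_add_le _ _).trans_lt ?_
      have h2 := hy.trans_le (min_le_right _ _)
      have h3 : ‖ι x - ι x₀‖ < η / 2 := hxη
      linarith
    exact ⟨h1.1, heR y, h1.2⟩
  have hdist : ∀ y, y ∈ e.source → e y ∈ V → m * ‖e y - u‖ ≤ ‖ι y - ι x‖ := by
    intro y hy hyV
    have := (hbi u huV (e y) hyV).1
    rwa [hFy y hy, hFy x hxs] at this
  obtain ⟨γ, hγT, hγ, hγn⟩ := exists_riesz_of_antilipschitz (fderivWithin ℝ F R u)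
    (fderivWithin ℝ (g ∘ e.symm) R u) hm (hA u huV) (hqg.bound u huV)
  refine ⟨(fderivWithin ℝ F R u : EuclideanSpace ℝ (Fin d) →ₗ[ℝ] H).range, γ, ?_, hγT, hγn.trans hC1, ?_, ?_, ?_⟩
  · rw [LinearMap.finrank_range_of_inj, finrank_euclideanSpace_fin]
    rw [injective_iff_map_eq_zero]
    intro w hw
    have h1 := hA u huV w
    have h2 : fderivWithin ℝ F R u w = 0 := hw
    rw [h2, norm_zero] at h1
    exact norm_le_zero_iff.1 (by nlinarith [norm_nonneg w])
  · intro y hy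
    obtain ⟨hys, hyV⟩ := hnear y hy
    have h1 := hqF.taylor u huV _ hyV
    have h2 := hqg.taylor u huV _ hyV
    rw [hFy y hys, hFy x hxs] at h1
    rw [hgy y hys, hgy x hxs] at h2
    have h3 : B * ‖e y - u‖ ^ 2 ≤ C * ‖ι y - ι x‖ ^ 2 := by
      have h4 : ‖e y - u‖ ≤ ‖ι y - ι x‖ / m := by
        rw [le_div_iff₀ hm, mul_comm]; exact hdist y hys hyV
      calc B * ‖e y - u‖ ^ 2 ≤ B * (‖ι y - ι x‖ / m) ^ 2 := by gcongr
        _ = B / m ^ 2 * ‖ι y - ι x‖ ^ 2 := by field_simp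
        _ ≤ _ := by gcongr
    refine ⟨fderivWithin ℝ F R u (e y - u), ⟨e y - u, rfl⟩, h1.trans h3, ?_⟩
    rw [hγ]
    exact h2.trans h3
  · intro h h0 hlt
    rw [riemVol, hmemb.comap_apply]
    have hsub : ι '' {y | ‖ι y - ι x‖ ≤ h} ⊆ F '' (V ∩ Metric.ball u (2 * h / m)) := by
      rintro _ ⟨y, hy, rfl⟩
      have hy' : ‖ι y - ι x‖ ≤ h := hy
      obtain ⟨hys, hyV⟩ := hnear y (hy'.trans_lt hlt)
      refine ⟨e y, ⟨hyV, ?_⟩, hFy y hys⟩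
      rw [mem_ball_iff_norm, lt_div_iff₀ hm, mul_comm]
      have := hdist y hys hyV
      linarith
    have hlip : LipschitzOnWith B.toNNReal F (V ∩ Metric.ball u (2 * h / m)) := by
      refine LipschitzOnWith.of_dist_le_mul fun a ha b hb => ?_
      rw [dist_eq_norm, dist_eq_norm, Real.coe_toNNReal _ hB.le]
      exact (hbi b hb.1 a ha.1).2
    refine (measure_mono hsub).trans ((hlip.euclideanHausdorffMeasure_image_le d).trans ?_)
    calc (B.toNNReal : ℝ≥0∞) ^ d * Measure.euclideanHausdorffMeasure d
          (V ∩ Metric.ball u (2 * h / m))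
        ≤ (B.toNNReal : ℝ≥0∞) ^ d * Measure.euclideanHausdorffMeasure d
          (Metric.ball u (2 * h / m)) := by gcongr; exact inter_subset_right
      _ = ENNReal.ofReal (B ^ d * ((2 * h / m) ^ d * ω)) := by
          rw [volume_ball_euclidean _ (by positivity),
            ENNReal.ofReal_mul (p := B ^ d) (by positivity), ENNReal.ofReal_pow hB.le]
          rfl
      _ ≤ _ := by
          apply ENNReal.ofReal_le_ofReal
          calc B ^ d * ((2 * h / m) ^ d * ω) = B ^ d * ((2 / m) ^ d * ω) * h ^ d := by
                rw [show 2 * h / m = 2 / m * h by ring, mul_pow]; ring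
            _ ≤ C * h ^ d := by gcongr
  · intro h h0 hlt
    obtain ⟨p, hp1, hp2, hp3⟩ := hcells u ⟨heR x, hxb⟩ h h0 (hlt.trans_le (min_le_left _ _))
    refine ⟨fun j => e.source ∩ e ⁻¹' Metric.ball (p j) (κ * h), ?_, ?_, ?_, ?_⟩
    · intro j
      rw [he, extChartAt_source]
      exact (isOpen_extChartAt_preimage x₀ Metric.isOpen_ball).measurableSet
    · intro j
      rw [riemVol, hmemb.comap_apply]
      have himg : F '' Metric.ball (p j) (κ * h) ⊆
          ι '' (e.source ∩ e ⁻¹' Metric.ball (p j) (κ * h)) := by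
        rintro _ ⟨y, hy, rfl⟩
        have hyt := hVt (hp1 j hy)
        refine ⟨e.symm y, ⟨e.map_target hyt, ?_⟩, rfl⟩
        rw [mem_preimage, e.right_inv hyt]
        exact hy
      refine le_trans ?_ (measure_mono himg)
      have hinjF : InjOn F (Metric.ball (p j) (κ * h)) := by
        intro a ha b hb hab
        have h1 := (hbi b (hp1 j hb) a (hp1 j ha)).1
        rw [hab, sub_self, norm_zero] at h1
        exact sub_eq_zero.1 (norm_le_zero_iff.1 (by nlinarith [norm_nonneg (a - b)]))
      have hlip : LipschitzOnWith (m⁻¹).toNNReal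
          (Function.invFunOn F (Metric.ball (p j) (κ * h))) (F '' Metric.ball (p j) (κ * h)) := by
        refine LipschitzOnWith.of_dist_le_mul ?_
        rintro _ ⟨a, ha, rfl⟩ _ ⟨b, hb, rfl⟩
        rw [hinjF.leftInvOn_invFunOn ha, hinjF.leftInvOn_invFunOn hb,
          Real.coe_toNNReal _ (by positivity), dist_eq_norm, dist_eq_norm, inv_mul_eq_div,
          le_div_iff₀ hm, mul_comm]
        exact (hbi b (hp1 j hb) a (hp1 j ha)).1
      have h1 := hlip.euclideanHausdorffMeasure_image_le d
      rw [hinjF.leftInvOn_invFunOn.image_image, volume_ball_euclidean _ (by positivity)] at h1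
      have h2 : ((m⁻¹).toNNReal : ℝ≥0∞) ^ d = ENNReal.ofReal ((m⁻¹) ^ d) := by
        rw [ENNReal.ofReal_pow (by positivity)]; rfl
      rw [h2] at h1
      calc ENNReal.ofReal (c' * h ^ d) ≤ ENNReal.ofReal (m ^ d * ((κ * h) ^ d * ω)) := by
            apply ENNReal.ofReal_le_ofReal
            calc c' * h ^ d ≤ ((m * κ) ^ d * ω) * h ^ d := by gcongr; exact min_le_right _ _
              _ = _ := by rw [mul_pow, mul_pow]; ring
        _ = ENNReal.ofReal (m ^ d) * ENNReal.ofReal ((κ * h) ^ d * ω) :=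
            ENNReal.ofReal_mul (by positivity)
        _ ≤ ENNReal.ofReal (m ^ d) * (ENNReal.ofReal ((m⁻¹) ^ d) *
            Measure.euclideanHausdorffMeasure d (F '' Metric.ball (p j) (κ * h))) := by gcongr
        _ = _ := by
            rw [← mul_assoc, ← ENNReal.ofReal_mul (by positivity), ← mul_pow,
              mul_inv_cancel₀ hm.ne', one_pow, ENNReal.ofReal_one, one_mul]
    · rintro j y ⟨hys, hy⟩
      have := hp2 j (e y) hy
      rwa [hFy y hys, hFy x hxs] at this
    · rintro a _ ⟨w, rfl⟩
      obtain ⟨j, hj⟩ := hp3 a w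
      refine ⟨j, ?_⟩
      rintro y ⟨hys, hy⟩
      have := hj (e y) hy
      rw [hFy y hys, hFy x hxs] at this
      exact le_trans (mul_le_mul_of_nonneg_right (min_le_left _ _) (by positivity)) this

theorem IsEmbeddedManifold.exists_localGeometry [IsManifold (𝓡∂ d) ((⊤ : ℕ∞) : WithTop ℕ∞) M]
    [CompactSpace M] {ι : M → H} (hι : IsEmbeddedManifold d ι) {g : M → ℝ}
    (hg : TwiceDiffBounded d g) {r₁ r₂ : ℝ} (hr₁ : 0 < r₁) (hr : r₁ < r₂) :
    ∃ c C h₀ : ℝ, 0 < c ∧ 0 < C ∧ 0 < h₀ ∧ ∀ x : M, ∃ T γ,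
      LocalGeometry d ι (riemVol d ι) g r₁ r₂ c C h₀ x T γ := by
  have key := (isCompact_univ (X := M)).induction_on
    (p := fun s => ∃ c C h₀ : ℝ, 0 < c ∧ 0 < C ∧ 0 < h₀ ∧ ∀ x ∈ s, ∃ T γ,
      LocalGeometry d ι (riemVol d ι) g r₁ r₂ c C h₀ x T γ)
    ⟨1, 1, 1, one_pos, one_pos, one_pos, fun x hx => absurd hx (notMem_empty x)⟩
    (fun s t hst ⟨c, C, h₀, a1, a2, a3, a4⟩ =>
      ⟨c, C, h₀, a1, a2, a3, fun x hx => a4 x (hst hx)⟩)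
    (fun s t ⟨c, C, h₀, a1, a2, a3, a4⟩ ⟨c', C', h₀', b1, b2, b3, b4⟩ =>
      ⟨min c c', max C C', min h₀ h₀', lt_min a1 b1, lt_max_of_lt_left a2, lt_min a3 b3,
        fun x hx => hx.elim
          (fun hx => by
            obtain ⟨T, γ, h⟩ := a4 x hx
            exact ⟨T, γ, h.mono (min_le_left _ _) (le_max_left _ _) (min_le_left _ _)⟩)
          (fun hx => by
            obtain ⟨T, γ, h⟩ := b4 x hx
            exact ⟨T, γ, h.mono (min_le_right _ _) (le_max_right _ _) (min_le_right _ _)⟩)⟩)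
    (fun x _ => by
      obtain ⟨U, hU, h⟩ := hι.exists_nhds_localGeometry hg hr₁ hr x
      exact ⟨U, mem_nhdsWithin_of_mem_nhds hU, h⟩)
  obtain ⟨c, C, h₀, a1, a2, a3, a4⟩ := key
  exact ⟨c, C, h₀, a1, a2, a3, fun x => a4 x (mem_univ x)⟩

end Manifold

section LocalLinearWeights

variable {H : Type*} [NormedAddCommGroup H] [InnerProductSpace ℝ H] {n m : ℕ}

/-- The weight of the `i`-th observation in the local linear estimator. -/
noncomputable def llWeight (K : ℝ → ℝ) (h : ℝ) (x : H) (Xh : Fin n → H) (m : ℕ) (φ : ℕ → H)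
    (i : Fin n) : ℝ :=
  let A := designMatrix x Xh m φ
  let W := weightMatrix K h x Xh m
  ((A.transpose * W * A)⁻¹ * A.transpose * W) 0 i

theorem gHat_eq_sum_llWeight (K : ℝ → ℝ) (h : ℝ) (x : H) (Xh : Fin n → H) (Y : Fin n → ℝ) (m : ℕ)
    (φ : ℕ → H) : gHat K h x Xh Y m φ = ∑ i, llWeight K h x Xh m φ i * Y i := rfl

theorem designMatrix_mulVec (x : H) (Xh : Fin n → H) (φ : ℕ → H) (c : Fin (m + 1) → ℝ)
    (i : Fin n) : (designMatrix x Xh m φ).mulVec c i =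
      c 0 + inner ℝ (∑ k : Fin m, c k.succ • φ k) (Xh i - x) := by
  rw [Matrix.mulVec, dotProduct, Fin.sum_univ_succ, sum_inner]
  simp only [designMatrix, Matrix.of_apply, Fin.cons_zero, Fin.cons_succ, one_mul]
  congr 1
  refine Finset.sum_congr rfl fun k _ => ?_
  rw [real_inner_smul_left, real_inner_comm, mul_comm]

/-- If the weighted design is nondegenerate, then the local linear weights reproduce affine
functions and are controlled by the kernel weights. -/
theorem llWeight_spec {K : ℝ → ℝ} {h lam r : ℝ} {x : H} {Xh : Fin n → H} {φ : ℕ → H}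
    (hφ : Orthonormal ℝ (fun k : Fin m => φ k)) (hh : 0 < h) (hlam : 0 < lam) (hr : 0 ≤ r)
    (hK : ∀ u, 0 ≤ K u) (hKr : ∀ u, K u ≠ 0 → |u| ≤ r)
    (hq : ∀ (a : ℝ), ∀ v ∈ Submodule.span ℝ (range fun k : Fin m => φ k),
      lam * (a ^ 2 + h ^ 2 * ‖v‖ ^ 2) ≤
        ∑ i, K (‖x - Xh i‖ / h) / h ^ m * (a + inner ℝ v (Xh i - x)) ^ 2) :
    (∀ (a : ℝ), ∀ v ∈ Submodule.span ℝ (range fun k : Fin m => φ k),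
      ∑ i, llWeight K h x Xh m φ i * (a + inner ℝ v (Xh i - x)) = a) ∧
    ∀ i, |llWeight K h x Xh m φ i| ≤ K (‖x - Xh i‖ / h) / h ^ m * ((1 + r) / lam) := by
  set A := designMatrix x Xh m φ with hA
  set W := weightMatrix K h x Xh m with hW
  set ω : Fin n → ℝ := fun i => K (‖x - Xh i‖ / h) / h ^ m with hω
  have hω0 : ∀ i, 0 ≤ ω i := fun i => div_nonneg (hK _) (by positivity)
  set S := A.transpose * W * A with hS
  have hspan : ∀ c : Fin (m + 1) → ℝ, (∑ k : Fin m, c k.succ • φ k) ∈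
      Submodule.span ℝ (range fun k : Fin m => φ k) := fun c =>
    Submodule.sum_mem _ fun k _ => Submodule.smul_mem _ _ (Submodule.subset_span ⟨k, rfl⟩)
  have hquad : ∀ c : Fin (m + 1) → ℝ, c ⬝ᵥ S.mulVec c = ∑ i, ω i * (A.mulVec c i) ^ 2 := by
    intro c
    rw [hS, ← Matrix.mulVec_mulVec, ← Matrix.mulVec_mulVec, Matrix.dotProduct_mulVec,
      Matrix.vecMul_transpose, dotProduct]
    refine Finset.sum_congr rfl fun i _ => ?_
    rw [hW, weightMatrix, Matrix.mulVec_diagonal]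
    ring
  have hlow : ∀ c : Fin (m + 1) → ℝ,
      lam * (c 0 ^ 2 + h ^ 2 * ‖∑ k : Fin m, c k.succ • φ k‖ ^ 2) ≤ c ⬝ᵥ S.mulVec c := by
    intro c
    rw [hquad]
    refine (hq (c 0) _ (hspan c)).trans (le_of_eq ?_)
    refine Finset.sum_congr rfl fun i _ => ?_
    rw [hA, designMatrix_mulVec]
  have hunit : IsUnit S.det := by
    rw [← Matrix.isUnit_iff_isUnit_det, ← Matrix.mulVec_injective_iff_isUnit]
    intro c c' hcc
    have h0 : S.mulVec (c - c') = 0 := by rw [Matrix.mulVec_sub]; exact sub_eq_zero.2 hcc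
    have h1 := hlow (c - c')
    rw [h0, dotProduct_zero] at h1
    set b := c - c' with hb
    have h2 : b 0 ^ 2 + h ^ 2 * ‖∑ k : Fin m, b k.succ • φ k‖ ^ 2 ≤ 0 := by
      by_contra! hpos
      have := mul_pos hlam hpos
      linarith
    have h3 : b 0 = 0 := by nlinarith [sq_nonneg (b 0), sq_nonneg (h * ‖∑ k : Fin m, b k.succ • φ k‖)]
    have h4 : ‖∑ k : Fin m, b k.succ • φ k‖ = 0 := by
      rw [h3] at h2
      have h5 : ‖∑ k : Fin m, b k.succ • φ k‖ ^ 2 ≤ 0 := by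
        have : 0 < h ^ 2 := by positivity
        by_contra! hpos
        have := mul_pos this hpos
        linarith
      exact pow_eq_zero_iff (two_ne_zero) |>.1 (le_antisymm h5 (sq_nonneg _))
    have h6 : ∀ k : Fin m, b k.succ = 0 := by
      intro k
      have := hφ.inner_right_fintype (fun k => b k.succ) k
      rw [norm_eq_zero.1 h4, inner_zero_right] at this
      exact this.symm
    have h7 : b = 0 := by
      funext k
      refine Fin.cases h3 h6 k
    exact sub_eq_zero.1 h7
  have hweq : ∀ i, llWeight K h x Xh m φ i = (S⁻¹ * A.transpose * W) 0 i := fun i => rfl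
  set s : Fin (m + 1) → ℝ := fun l => S⁻¹ 0 l with hs
  have hwi : ∀ i, llWeight K h x Xh m φ i = ω i * A.mulVec s i := by
    intro i
    rw [hweq, hW, weightMatrix, Matrix.mul_diagonal, mul_comm]
    congr 1
    rw [Matrix.mul_apply, Matrix.mulVec, dotProduct]
    refine Finset.sum_congr rfl fun l _ => ?_
    rw [Matrix.transpose_apply, mul_comm]
  constructor
  · intro a v hv
    obtain ⟨b, rfl⟩ := (Submodule.mem_span_range_iff_exists_fun ℝ).1 hv
    set c : Fin (m + 1) → ℝ := Fin.cons a b with hc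
    have h1 : ∀ i, a + inner ℝ (∑ k, b k • φ k) (Xh i - x) = A.mulVec c i := by
      intro i
      rw [hA, designMatrix_mulVec]
      simp [hc]
    have h2 : (S⁻¹ * A.transpose * W).mulVec (A.mulVec c) 0 = a := by
      rw [Matrix.mulVec_mulVec, Matrix.mul_assoc, Matrix.mul_assoc, ← Matrix.mul_assoc A.transpose,
        ← hS, Matrix.nonsing_inv_mul _ hunit, Matrix.one_mulVec]
      rfl
    simp only [h1]
    exact h2
  · intro i
    have hss : s ⬝ᵥ S.mulVec s = s 0 := by
      have : Matrix.vecMul s S = Pi.single 0 1 := by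
        funext l
        have h1 : (S⁻¹ * S) 0 l = (1 : Matrix (Fin (m + 1)) (Fin (m + 1)) ℝ) 0 l := by
          rw [Matrix.nonsing_inv_mul _ hunit]
        rw [Matrix.mul_apply] at h1
        rw [Matrix.vecMul, dotProduct, h1, Matrix.one_apply, Pi.single_apply]
        simp [eq_comm]
      rw [Matrix.dotProduct_mulVec, this, single_dotProduct, one_mul]
    have h1 := hlow s
    rw [hss] at h1
    set B := ‖∑ k : Fin m, s k.succ • φ k‖ with hB
    have hB0 : 0 ≤ B := norm_nonneg _
    have hs0 : 0 ≤ s 0 := le_trans (by positivity) h1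
    have hs1 : s 0 ≤ 1 / lam := by
      rw [le_div_iff₀ hlam]
      by_contra! hcon
      have h2 : lam * s 0 ^ 2 ≤ s 0 := by nlinarith [mul_nonneg hlam.le (sq_nonneg (h * B))]
      have h3 : 0 < s 0 := by
        by_contra! h4
        have : s 0 = 0 := le_antisymm h4 hs0
        rw [this] at hcon; linarith
      nlinarith
    have hs2 : h * B ≤ 1 / lam := by
      refine abs_le_of_sq_le_sq' ?_ (by positivity) |>.2
      rw [div_pow, one_pow, le_div_iff₀ (by positivity)]
      have h2 : lam * (h * B) ^ 2 ≤ 1 / lam := by nlinarith [mul_nonneg hlam.le (sq_nonneg (s 0))]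
      rw [le_div_iff₀ hlam] at h2
      nlinarith
    rw [hwi, abs_mul, abs_of_nonneg (hω0 i)]
    rcases (hω0 i).eq_or_lt with h0 | h0
    · change ω i * _ ≤ ω i * _
      rw [← h0]; simp
    change ω i * _ ≤ ω i * _
    gcongr
    have hKne : K (‖x - Xh i‖ / h) ≠ 0 := fun h2 => by
      simp only [hω, h2, zero_div, lt_self_iff_false] at h0
    have hz : ‖Xh i - x‖ ≤ r * h := by
      have := hKr _ hKne
      rw [abs_of_nonneg (by positivity), div_le_iff₀ hh] at this
      rwa [norm_sub_rev]
    rw [hA, designMatrix_mulVec]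
    calc |s 0 + inner ℝ (∑ k : Fin m, s k.succ • φ k) (Xh i - x)|
        ≤ |s 0| + |inner ℝ (∑ k : Fin m, s k.succ • φ k) (Xh i - x)| := abs_add_le _ _
      _ ≤ 1 / lam + B * (r * h) := by
          rw [abs_of_nonneg hs0]
          refine add_le_add hs1 ((abs_real_inner_le_norm _ _).trans ?_)
          gcongr
      _ = 1 / lam + r * (h * B) := by ring
      _ ≤ 1 / lam + r * (1 / lam) := by gcongr
      _ = (1 + r) / lam := by ring

end LocalLinearWeights

section PCA

variable {H : Type*} [NormedAddCommGroup H] [InnerProductSpace ℝ H] {n d : ℕ}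

/-- Top eigenvectors of the local covariance operator of points near `x + T` are close to `T`. -/
theorem norm_orthogonal_topEigenvector_le {T : Submodule ℝ H} [FiniteDimensional ℝ T]
    (hT : Module.finrank ℝ T = d) {h lam τ : ℝ} {x : H} {Xh : Fin n → H} {φ : ℕ → H}
    (hh : 0 < h) (hlam : 0 < lam) (hN : (nbhd h x Xh).Nonempty)
    (htan : ∀ i ∈ nbhd h x Xh, ∃ t ∈ T, ‖Xh i - x - t‖ ≤ τ * h)
    (hlow : ∀ (a : ℝ), ∀ v ∈ T, lam * h ^ 2 * ‖v‖ ^ 2 * (nbhd h x Xh).card ≤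
      ∑ i ∈ nbhd h x Xh, (a + inner ℝ v (Xh i - x)) ^ 2)
    (hφ : IsTopEigenbasis (localCov h x Xh) d φ) {k : ℕ} (hk : k < d) :
    ‖Tᗮ.starProjection (φ k)‖ ≤ 4 * τ / lam := by
  obtain ⟨hon, ρ, hρ⟩ := hφ
  obtain ⟨heig, hmax⟩ := hρ k hk
  set N := nbhd h x Xh with hNdef
  have hcard : (0 : ℝ) < N.card := by exact_mod_cast hN.card_pos
  set xbar := localMean h x Xh with hxbar
  set Q := Tᗮ.starProjection with hQ
  have hQT : ∀ t ∈ T, Q t = 0 := by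
    intro t ht
    rw [hQ, Submodule.starProjection_orthogonal_val, Submodule.starProjection_eq_self_iff.2 ht,
      sub_self]
  have hQn : ∀ v, ‖Q v‖ ≤ ‖v‖ := Submodule.norm_starProjection_apply_le _
  have hz : ∀ i ∈ N, ‖Xh i - x‖ ≤ h := by
    intro i hi
    have : ‖x - Xh i‖ < h := by simpa [hNdef, nbhd] using hi
    rw [norm_sub_rev]; exact this.le
  have hQz : ∀ i ∈ N, ‖Q (Xh i - x)‖ ≤ τ * h := by
    intro i hi
    obtain ⟨t, ht, h1⟩ := htan i hi
    have : Q (Xh i - x) = Q (Xh i - x - t) := by rw [map_sub Q _ t, hQT t ht, sub_zero]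
    rw [this]
    exact (hQn _).trans h1
  have hmean : xbar - x = (N.card : ℝ)⁻¹ • ∑ i ∈ N, (Xh i - x) := by
    rw [hxbar, localMean, Finset.sum_sub_distrib, smul_sub, Finset.sum_const,
      ← Nat.cast_smul_eq_nsmul ℝ, smul_smul, inv_mul_cancel₀ hcard.ne', one_smul]
  have havg : ∀ (f : Fin n → H) (b : ℝ), (∀ i ∈ N, ‖f i‖ ≤ b) →
      ‖(N.card : ℝ)⁻¹ • ∑ i ∈ N, f i‖ ≤ b := by
    intro f b hb
    rw [norm_smul, Real.norm_of_nonneg (by positivity), inv_mul_le_iff₀ hcard]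
    refine (norm_sum_le _ _).trans ((Finset.sum_le_card_nsmul _ _ _ hb).trans (le_of_eq ?_))
    rw [nsmul_eq_mul]
  have hm1 : ‖xbar - x‖ ≤ h := by rw [hmean]; exact havg _ _ hz
  have hm2 : ‖Q (xbar - x)‖ ≤ τ * h := by
    rw [hmean, map_smul, map_sum]; exact havg _ _ hQz
  have hδ1 : ∀ i ∈ N, ‖Xh i - xbar‖ ≤ 2 * h := by
    intro i hi
    have : Xh i - xbar = (Xh i - x) - (xbar - x) := by abel
    rw [this]
    exact (norm_sub_le _ _).trans (by linarith [hz i hi])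
  have hδ2 : ∀ i ∈ N, ‖Q (Xh i - xbar)‖ ≤ 2 * τ * h := by
    intro i hi
    have : Xh i - xbar = (Xh i - x) - (xbar - x) := by abel
    rw [this, map_sub]
    exact (norm_sub_le _ _).trans (by linarith [hQz i hi])
  have hρlow : lam * h ^ 2 ≤ ρ k := by
    obtain ⟨v, hvker, hv0⟩ : ∃ v ∈ (LinearMap.pi (fun j : Fin k =>
        (innerₗ H (φ j)).comp T.subtype)).ker, v ≠ 0 := by
      refine (Submodule.ne_bot_iff _).1 (LinearMap.ker_ne_bot_of_finrank_lt ?_)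
      rw [Module.finrank_fin_fun, hT]; exact hk
    have h1 : ∀ j < k, inner ℝ (φ j) (v : H) = 0 := by
      intro j hj
      exact congrFun (LinearMap.mem_ker.1 hvker) ⟨j, hj⟩
    have h2 := hmax v h1
    have h3 : inner ℝ (localCov h x Xh v) (v : H) =
        (N.card : ℝ)⁻¹ * ∑ i ∈ N, (-inner ℝ (v : H) (xbar - x) + inner ℝ (v : H) (Xh i - x)) ^ 2 := by
      rw [localCov, real_inner_smul_left, sum_inner]
      congr 1
      refine Finset.sum_congr rfl fun i _ => ?_
      rw [real_inner_smul_left, real_inner_comm, ← sq]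
      congr 1
      rw [← sub_sub_sub_cancel_right (Xh i) _ x, inner_sub_right]
      ring
    have h4 := hlow (-inner ℝ (v : H) (xbar - x)) v v.2
    have hvpos : 0 < ‖(v : H)‖ ^ 2 := by
      have : (v : H) ≠ 0 := by simpa using hv0
      positivity
    refine le_of_mul_le_mul_right ?_ hvpos
    refine le_trans ?_ h2
    rw [h3, inv_mul_eq_div, le_div_iff₀ hcard]
    exact h4
  have hρpos : 0 < ρ k := lt_of_lt_of_le (by positivity) hρlow
  have hnorm : ‖φ k‖ = 1 := hon.1 ⟨k, hk⟩
  have hmain : ρ k * ‖Q (φ k)‖ ≤ 4 * τ * h ^ 2 := by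
    have h1 : ρ k * ‖Q (φ k)‖ = ‖Q (localCov h x Xh (φ k))‖ := by
      rw [heig, map_smul, norm_smul, Real.norm_of_nonneg hρpos.le]
    rw [h1, localCov, map_smul, map_sum]
    refine havg _ _ fun i hi => ?_
    rw [map_smul, norm_smul]
    calc ‖inner ℝ (Xh i - xbar) (φ k)‖ * ‖Q (Xh i - xbar)‖ ≤ (2 * h) * (2 * τ * h) := by
          gcongr
          · refine (norm_inner_le_norm _ _).trans ?_
            rw [hnorm, mul_one]
            exact hδ1 i hi
          · exact hδ2 i hi
      _ = 4 * τ * h ^ 2 := by ring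
  rw [le_div_iff₀ hlam]
  have h5 : (lam * h ^ 2) * ‖Q (φ k)‖ ≤ 4 * τ * h ^ 2 :=
    (mul_le_mul_of_nonneg_right hρlow (norm_nonneg _)).trans hmain
  have : 0 < h ^ 2 := by positivity
  refine le_of_mul_le_mul_right ?_ this
  linarith

theorem norm_orthogonal_le_of_mem_span {T : Submodule ℝ H} [FiniteDimensional ℝ T] {φ : ℕ → H}
    (hφ : Orthonormal ℝ (fun k : Fin d => φ k)) {b : ℝ}
    (hb : ∀ k < d, ‖Tᗮ.starProjection (φ k)‖ ≤ b) {v : H}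
    (hv : v ∈ Submodule.span ℝ (range fun k : Fin d => φ k)) :
    ‖Tᗮ.starProjection v‖ ≤ d * b * ‖v‖ := by
  obtain ⟨c, rfl⟩ := (Submodule.mem_span_range_iff_exists_fun ℝ).1 hv
  have hc : ∀ k, |c k| ≤ ‖∑ k, c k • φ k‖ := by
    intro k
    have h1 := hφ.inner_right_fintype c k
    rw [← h1]
    refine (abs_real_inner_le_norm _ _).trans ?_
    rw [hφ.1 k, one_mul]
  rw [map_sum]
  calc ‖∑ k, Tᗮ.starProjection (c k • φ k)‖ ≤ ∑ k, ‖Tᗮ.starProjection (c k • φ k)‖ :=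
        norm_sum_le _ _
    _ ≤ ∑ _k : Fin d, ‖∑ k, c k • φ k‖ * b := by
        refine Finset.sum_le_sum fun k _ => ?_
        rw [map_smul, norm_smul]
        have := hb k k.2
        gcongr
        exact hc k
    _ = _ := by simp; ring

/-- If all vectors of the span of `φ` are close to `T`, then every vector of `T` is the orthogonal
projection of a vector of comparable size in the span. -/
theorem exists_mem_span_starProjection_eq {T : Submodule ℝ H} [FiniteDimensional ℝ T]
    (hT : Module.finrank ℝ T = d) {φ : ℕ → H} (hφ : Orthonormal ℝ (fun k : Fin d => φ k))
    (hb : ∀ v ∈ Submodule.span ℝ (range fun k : Fin d => φ k),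
      ‖Tᗮ.starProjection v‖ ≤ ‖v‖ / 2) {γ : H} (hγ : γ ∈ T) :
    ∃ v ∈ Submodule.span ℝ (range fun k : Fin d => φ k),
      T.starProjection v = γ ∧ ‖v‖ ≤ 2 * ‖γ‖ := by
  set W := Submodule.span ℝ (range fun k : Fin d => φ k) with hW
  have hfr : Module.finrank ℝ W = d := by
    rw [hW, finrank_span_eq_card hφ.linearIndependent, Fintype.card_fin]
  have : FiniteDimensional ℝ W := FiniteDimensional.span_of_finite ℝ (finite_range _)
  have hle : ∀ v ∈ W, ‖v‖ ≤ 2 * ‖T.starProjection v‖ := by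
    intro v hv
    have h1 := hb v hv
    rw [Submodule.starProjection_orthogonal_val] at h1
    have h2 := norm_sub_norm_le v (T.starProjection v)
    linarith
  set P : W →ₗ[ℝ] T := (T.orthogonalProjectionOnto : H →ₗ[ℝ] T).comp W.subtype with hP
  have hPv : ∀ w : W, ((P w : T) : H) = T.starProjection (w : H) := fun w => rfl
  have hinj : Function.Injective P := by
    rw [injective_iff_map_eq_zero]
    intro w hw
    have h1 := hle w w.2
    rw [← hPv, hw] at h1
    have : ‖(w : H)‖ ≤ 0 := by simpa using h1
    exact_mod_cast norm_le_zero_iff.1 this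
  obtain ⟨w, hw⟩ := (LinearMap.injective_iff_surjective_of_finrank_eq_finrank
    (hfr.trans hT.symm)).1 hinj ⟨γ, hγ⟩
  have hwγ : T.starProjection (w : H) = γ := by rw [← hPv, hw]
  refine ⟨w, w.2, hwγ, ?_⟩
  rw [← hwγ]
  exact hle w w.2

end PCA

section RegularSample

variable {H : Type*} [NormedAddCommGroup H] [InnerProductSpace ℝ H] {n d : ℕ}

/-- For every affine function on `T`, at least `c₁ n h ^ d` of the sample points at distance of
order `h` from `x` lie where the function is large. -/
def WellSpread (d : ℕ) (T : Submodule ℝ H) (x : H) (P : Fin n → H) (r₁ r₂ c c₁ h : ℝ) : Prop :=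
  ∀ a : ℝ, ∀ v ∈ T, ∃ J : Finset (Fin n), c₁ * n * h ^ d ≤ J.card ∧
    ∀ i ∈ J, r₁ * h ≤ ‖P i - x‖ ∧ ‖P i - x‖ ≤ r₂ * h ∧
      c * (|a| + h * ‖v‖) ≤ |a + inner ℝ v (P i - x)|

theorem orthogonal_le_of_wellSpread {T : Submodule ℝ H} [FiniteDimensional ℝ T]
    (hT : Module.finrank ℝ T = d) {x : H} {P Xh : Fin n → H} {φ : ℕ → H}
    {r₁ r₂ c c₁ C C₁ h h₀ α : ℝ} (hn : 0 < n) (hh : 0 < h) (hc : 0 < c) (hc₁ : 0 < c₁)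
    (hC : 0 < C) (hC₁ : 0 < C₁)
    (hspread : WellSpread d T x P r₁ r₂ c c₁ h)
    (hcount : (({i | ‖P i - x‖ ≤ 2 * h} : Finset (Fin n)).card : ℝ) ≤ C₁ * n * h ^ d)
    (hα : ∀ i, ‖Xh i - P i‖ ≤ α) (hα₁ : α < (1 - r₂) * h) (hα₂ : α ≤ c / 2 * h) (hα₃ : α ≤ h)
    (htan : ∀ i, ‖P i - x‖ < h₀ → ∃ t ∈ T, ‖P i - x - t‖ ≤ C * ‖P i - x‖ ^ 2)
    (hh₀ : 2 * h < h₀) (hφ : IsTopEigenbasis (localCov h x Xh) d φ) {v : H}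
    (hv : v ∈ Submodule.span ℝ (range fun k : Fin d => φ k)) :
    ‖Tᗮ.starProjection v‖ ≤ d * (4 * (α / h + 4 * C * h) / (c₁ / C₁ * (c ^ 2 / 4))) * ‖v‖ := by
  have hα0 : 0 ≤ α := (norm_nonneg _).trans (hα ⟨0, hn⟩)
  have hn' : (0 : ℝ) < n := by exact_mod_cast hn
  have hmem : ∀ i, ‖P i - x‖ ≤ r₂ * h → i ∈ nbhd h x Xh := by
    intro i hi
    simp only [nbhd, Finset.mem_filter, Finset.mem_univ, true_and]
    have : x - Xh i = -((Xh i - P i) + (P i - x)) := by abel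
    rw [this, norm_neg]
    exact (norm_add_le _ _).trans_lt (by linarith [hα i])
  have hnb : ∀ i ∈ nbhd h x Xh, ‖P i - x‖ ≤ 2 * h := by
    intro i hi
    have h1 : ‖x - Xh i‖ < h := by simpa [nbhd] using hi
    rw [norm_sub_rev] at h1
    have : P i - x = (Xh i - x) - (Xh i - P i) := by abel
    rw [this]
    exact (norm_sub_le _ _).trans (by linarith [hα i])
  have hcard : ((nbhd h x Xh).card : ℝ) ≤ C₁ * n * h ^ d := by
    refine le_trans ?_ hcount
    exact_mod_cast Finset.card_le_card fun i hi => by simpa using hnb i hi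
  refine norm_orthogonal_le_of_mem_span hφ.1 (fun k hk => ?_) hv
  refine norm_orthogonal_topEigenvector_le hT hh (by positivity) ?_ ?_ ?_ hφ hk
  · obtain ⟨J, hJ, hJi⟩ := hspread 0 0 T.zero_mem
    have hpos : (0 : ℝ) < J.card := lt_of_lt_of_le (by positivity) hJ
    obtain ⟨i, hi⟩ := Finset.card_pos.1 (by exact_mod_cast hpos)
    exact ⟨i, hmem i (hJi i hi).2.1⟩
  · intro i hi
    have h1 := hnb i hi
    obtain ⟨t, ht, h2⟩ := htan i (h1.trans_lt hh₀)
    refine ⟨t, ht, ?_⟩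
    have : Xh i - x - t = (Xh i - P i) + (P i - x - t) := by abel
    rw [this]
    refine (norm_add_le _ _).trans ((add_le_add (hα i) h2).trans ?_)
    calc α + C * ‖P i - x‖ ^ 2 ≤ α + C * (2 * h) ^ 2 := by gcongr
      _ = (α / h + 4 * C * h) * h := by field_simp; ring
  · intro a v hv
    obtain ⟨J, hJ, hJi⟩ := hspread a v hv
    have hsub : J ⊆ nbhd h x Xh := fun i hi => hmem i (hJi i hi).2.1
    calc c₁ / C₁ * (c ^ 2 / 4) * h ^ 2 * ‖v‖ ^ 2 * (nbhd h x Xh).card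
        ≤ c₁ / C₁ * (c ^ 2 / 4) * h ^ 2 * ‖v‖ ^ 2 * (C₁ * n * h ^ d) := by gcongr
      _ = (c₁ * n * h ^ d) * (c / 2 * h * ‖v‖) ^ 2 := by field_simp; ring
      _ ≤ J.card * (c / 2 * h * ‖v‖) ^ 2 := by gcongr
      _ = ∑ i ∈ J, (c / 2 * h * ‖v‖) ^ 2 := by rw [Finset.sum_const, nsmul_eq_mul]
      _ ≤ ∑ i ∈ J, (a + inner ℝ v (Xh i - x)) ^ 2 := by
          refine Finset.sum_le_sum fun i hi => ?_
          rw [← sq_abs (a + _)]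
          gcongr
          have h1 := (hJi i hi).2.2
          have h2 : a + inner ℝ v (P i - x) = (a + inner ℝ v (Xh i - x)) -
              inner ℝ v (Xh i - P i) := by
            rw [add_sub_assoc, ← inner_sub_right]; congr 2; abel
          have h3 : |inner ℝ v (Xh i - P i)| ≤ ‖v‖ * (c / 2 * h) :=
            (abs_real_inner_le_norm _ _).trans (by gcongr; exact (hα i).trans hα₂)
          have h4 := abs_sub (a + inner ℝ v (Xh i - x)) (inner ℝ v (Xh i - P i))
          rw [← h2] at h4
          have h5 : 0 ≤ c * |a| := by positivity
          linarith
      _ ≤ _ := Finset.sum_le_sum_of_subset_of_nonneg hsub fun _ _ _ => sq_nonneg _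

/-- The bounds on the local linear weights: the sum of their squares is of order `(n h ^ d)⁻¹`, and
the bias is of order `h ^ 2`. -/
theorem llWeight_bounds {T : Submodule ℝ H} [FiniteDimensional ℝ T]
    (hT : Module.finrank ℝ T = d) {x γ : H} {P Xh : Fin n → H} {G : Fin n → ℝ} {g₀ : ℝ}
    {φ : ℕ → H} {K : ℝ → ℝ} {r₁ r₂ s k₀ k₁ R c c₁ C C₁ h h₀ α : ℝ} (hn : 0 < n) (hh : 0 < h)
    (hc : 0 < c) (hc₁ : 0 < c₁) (hC : 0 < C) (hC₁ : 0 < C₁) (hr₂ : r₂ ≤ 1)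
    (hK : ∀ u, 0 ≤ K u) (hR : 0 ≤ R) (hKR : ∀ u, K u ≠ 0 → |u| ≤ R) (hk₀ : 0 < k₀)
    (hKk : ∀ u ∈ Icc (r₁ - s) (r₂ + s), k₀ ≤ K u) (hk₁ : ∀ u, K u ≤ k₁)
    (hspread : WellSpread d T x P r₁ r₂ c c₁ h)
    (hcount : (({i | ‖P i - x‖ ≤ (R + 1) * h} : Finset (Fin n)).card : ℝ) ≤ C₁ * n * h ^ d)
    (hα : ∀ i, ‖Xh i - P i‖ ≤ α) (hα₁ : α ≤ s * h) (hα₂ : α ≤ c / 8 * h) (hα₃ : α ≤ h)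
    (hα₄ : α ≤ h ^ 2)
    (hγ : γ ∈ T) (hγC : ‖γ‖ ≤ C)
    (htan : ∀ i, ‖P i - x‖ < h₀ → ∃ t ∈ T, ‖P i - x - t‖ ≤ C * ‖P i - x‖ ^ 2 ∧
      |G i - g₀ - inner ℝ γ t| ≤ C * ‖P i - x‖ ^ 2)
    (hh₀ : (R + 1) * h < h₀) (hφ : Orthonormal ℝ (fun k : Fin d => φ k)) {θ : ℝ}
    (hθ : ∀ v ∈ Submodule.span ℝ (range fun k : Fin d => φ k), ‖Tᗮ.starProjection v‖ ≤ θ * ‖v‖)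
    (hθ₁ : θ ≤ 1 / 2) (hθ₂ : θ ≤ c / 8) :
    let lam₀ := c₁ * k₀ * (c / 4) ^ 2
    let L := k₁ * C₁ * (1 + R) / lam₀
    ∑ i, llWeight K h x Xh d φ i ^ 2 ≤ k₁ * (1 + R) / lam₀ * L / (n * h ^ d) ∧
    |∑ i, llWeight K h x Xh d φ i * G i - g₀| ≤
      L * (C * (R + 1) ^ 2 * (1 + 2 * C) + 2 * C) * h ^ 2 := by
  intro lam₀ L
  have hn' : (0 : ℝ) < n := by exact_mod_cast hn
  have hlam₀ : 0 < lam₀ := by positivity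
  have hk₁0 : 0 ≤ k₁ := (hK 0).trans (hk₁ 0)
  have hL : 0 ≤ L := by positivity
  have hα0 : 0 ≤ α := (norm_nonneg _).trans (hα ⟨0, hn⟩)
  set W := Submodule.span ℝ (range fun k : Fin d => φ k) with hW
  set ω : Fin n → ℝ := fun i => K (‖x - Xh i‖ / h) / h ^ d with hω
  have hω0 : ∀ i, 0 ≤ ω i := fun i => div_nonneg (hK _) (by positivity)
  have hsplit : ∀ v, v = T.starProjection v + Tᗮ.starProjection v := by
    intro v
    rw [Submodule.starProjection_orthogonal_val]; abel
  have hproj : ∀ v ∈ W, ‖v‖ / 2 ≤ ‖T.starProjection v‖ := by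
    intro v hv
    have h1 := hθ v hv
    have h2 : ‖v‖ ≤ ‖T.starProjection v‖ + ‖Tᗮ.starProjection v‖ := by
      conv_lhs => rw [hsplit v]
      exact norm_add_le _ _
    have h3 : θ * ‖v‖ ≤ 1 / 2 * ‖v‖ := by gcongr
    linarith
  have hq : ∀ (a : ℝ), ∀ v ∈ W, (n * lam₀) * (a ^ 2 + h ^ 2 * ‖v‖ ^ 2) ≤
      ∑ i, ω i * (a + inner ℝ v (Xh i - x)) ^ 2 := by
    intro a v hv
    obtain ⟨J, hJ, hJi⟩ := hspread a (T.starProjection v) (T.starProjection_apply_mem v)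
    calc (n * lam₀) * (a ^ 2 + h ^ 2 * ‖v‖ ^ 2)
        ≤ (n * lam₀) * (|a| + h * ‖v‖) ^ 2 := by
          gcongr
          have : 0 ≤ |a| * (h * ‖v‖) := by positivity
          rw [← sq_abs a]
          nlinarith
      _ = (c₁ * n * h ^ d) * (k₀ / h ^ d * (c / 4 * (|a| + h * ‖v‖)) ^ 2) := by
          simp only [lam₀]; field_simp
      _ ≤ J.card * (k₀ / h ^ d * (c / 4 * (|a| + h * ‖v‖)) ^ 2) := by gcongr
      _ = ∑ i ∈ J, (k₀ / h ^ d * (c / 4 * (|a| + h * ‖v‖)) ^ 2) := by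
          rw [Finset.sum_const, nsmul_eq_mul]
      _ ≤ ∑ i ∈ J, ω i * (a + inner ℝ v (Xh i - x)) ^ 2 := by
          refine Finset.sum_le_sum fun i hi => ?_
          obtain ⟨j1, j2, j3⟩ := hJi i hi
          have e1 : Xh i - x = (P i - x) + (Xh i - P i) := by abel
          have hKi : k₀ ≤ K (‖x - Xh i‖ / h) := by
            refine hKk _ ?_
            rw [norm_sub_rev x, mem_Icc, le_div_iff₀ hh, div_le_iff₀ hh]
            have e2 := norm_add_le (P i - x) (Xh i - P i)
            have e3 := norm_sub_norm_le (P i - x) (-(Xh i - P i))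
            rw [sub_neg_eq_add, norm_neg] at e3
            rw [← e1] at e2 e3
            have := hα i
            constructor <;> linarith
          rw [← sq_abs (a + _)]
          simp only [hω]
          have hKi0 := hK (‖x - Xh i‖ / h)
          gcongr
          have e4 : a + inner ℝ (T.starProjection v) (P i - x) = (a + inner ℝ v (Xh i - x)) -
              (inner ℝ (Tᗮ.starProjection v) (P i - x) + inner ℝ v (Xh i - P i)) := by
            rw [Submodule.starProjection_orthogonal_val, e1, inner_add_right, inner_sub_left]
            ring
          have e5 : |inner ℝ (Tᗮ.starProjection v) (P i - x)| ≤ c / 8 * ‖v‖ * h := by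
            refine (abs_real_inner_le_norm _ _).trans ?_
            gcongr
            · exact (hθ v hv).trans (by gcongr)
            · exact j2.trans (by nlinarith)
          have e6 : |inner ℝ v (Xh i - P i)| ≤ ‖v‖ * (c / 8 * h) :=
            (abs_real_inner_le_norm _ _).trans (by gcongr; exact (hα i).trans hα₂)
          have e7 := abs_sub (a + inner ℝ v (Xh i - x))
            (inner ℝ (Tᗮ.starProjection v) (P i - x) + inner ℝ v (Xh i - P i))
          have e8 := abs_add_le (inner ℝ (Tᗮ.starProjection v) (P i - x)) (inner ℝ v (Xh i - P i))
          rw [← e4] at e7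
          have e9 : c * (h * (‖v‖ / 2)) ≤ c * (h * ‖T.starProjection v‖) := by
            gcongr; exact hproj v hv
          have e10 : 0 ≤ c * |a| := by positivity
          linarith
      _ ≤ _ := Finset.sum_le_sum_of_subset_of_nonneg (Finset.subset_univ _)
          fun i _ _ => mul_nonneg (hω0 i) (sq_nonneg _)
  obtain ⟨hrep, hwb⟩ := llWeight_spec hφ hh (mul_pos hn' hlam₀) hR hK hKR hq
  have hne : ∀ i, ω i ≠ 0 → ‖P i - x‖ ≤ (R + 1) * h := by
    intro i hi
    have h1 : K (‖x - Xh i‖ / h) ≠ 0 := fun h2 => hi (by simp only [hω, h2, zero_div])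
    have h2 := hKR _ h1
    rw [abs_of_nonneg (by positivity), div_le_iff₀ hh, norm_sub_rev] at h2
    have : P i - x = (Xh i - x) - (Xh i - P i) := by abel
    rw [this]
    exact (norm_sub_le _ _).trans (by linarith [hα i])
  have hωsum : ∑ i, ω i ≤ k₁ * C₁ * n := by
    calc ∑ i, ω i ≤ ∑ i ∈ ({i | ‖P i - x‖ ≤ (R + 1) * h} : Finset (Fin n)), k₁ / h ^ d := by
          rw [Finset.sum_filter]
          refine Finset.sum_le_sum fun i _ => ?_
          split_ifs with hi
          · simp only [hω]; gcongr; exact hk₁ _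
          · by_contra! hcon
            exact hi (hne i hcon.ne')
      _ = ({i | ‖P i - x‖ ≤ (R + 1) * h} : Finset (Fin n)).card * (k₁ / h ^ d) := by
          rw [Finset.sum_const, nsmul_eq_mul]
      _ ≤ (C₁ * n * h ^ d) * (k₁ / h ^ d) := by gcongr
      _ = _ := by field_simp
  have habs : ∑ i, |llWeight K h x Xh d φ i| ≤ L := by
    calc ∑ i, |llWeight K h x Xh d φ i| ≤ ∑ i, ω i * ((1 + R) / (n * lam₀)) :=
          Finset.sum_le_sum fun i _ => hwb i
      _ = (∑ i, ω i) * ((1 + R) / (n * lam₀)) := by rw [Finset.sum_mul]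
      _ ≤ (k₁ * C₁ * n) * ((1 + R) / (n * lam₀)) := by gcongr
      _ = L := by simp only [L]; field_simp
  constructor
  · calc ∑ i, llWeight K h x Xh d φ i ^ 2
        ≤ ∑ i, (k₁ / h ^ d * ((1 + R) / (n * lam₀))) * |llWeight K h x Xh d φ i| := by
          refine Finset.sum_le_sum fun i _ => ?_
          rw [← sq_abs, sq]
          gcongr
          refine (hwb i).trans ?_
          gcongr
          exact hk₁ _
      _ = (k₁ / h ^ d * ((1 + R) / (n * lam₀))) * ∑ i, |llWeight K h x Xh d φ i| := by
          rw [Finset.mul_sum]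
      _ ≤ (k₁ / h ^ d * ((1 + R) / (n * lam₀))) * L := by gcongr
      _ = _ := by field_simp
  · obtain ⟨v, hv, hvγ, hvn⟩ := exists_mem_span_starProjection_eq hT hφ
      (fun v hv => (hθ v hv).trans (by nlinarith [norm_nonneg v])) hγ
    have hres : ∀ i, ω i ≠ 0 → |G i - (g₀ + inner ℝ v (Xh i - x))| ≤
        (C * (R + 1) ^ 2 * (1 + 2 * C) + 2 * C) * h ^ 2 := by
      intro i hi
      have h1 := hne i hi
      obtain ⟨t, ht, h2, h3⟩ := htan i (h1.trans_lt hh₀)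
      have h4 : C * ‖P i - x‖ ^ 2 ≤ C * (R + 1) ^ 2 * h ^ 2 := by
        rw [mul_assoc, ← mul_pow]; gcongr
      have h5 : inner ℝ v t = inner ℝ γ t := by
        rw [← hvγ, ← sub_eq_zero, ← inner_sub_left]
        exact Submodule.starProjection_inner_eq_zero v t ht
      have h6 : G i - (g₀ + inner ℝ v (Xh i - x)) = (G i - g₀ - inner ℝ γ t) -
          (inner ℝ v (P i - x - t) + inner ℝ v (Xh i - P i)) := by
        have : Xh i - x = t + (P i - x - t) + (Xh i - P i) := by abel
        rw [this, inner_add_right, inner_add_right, h5]; ring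
      rw [h6]
      have hv2 : ‖v‖ ≤ 2 * C := by linarith
      have h7 : |inner ℝ v (P i - x - t)| ≤ 2 * C * (C * (R + 1) ^ 2 * h ^ 2) :=
        (abs_real_inner_le_norm _ _).trans (by gcongr; exact h2.trans h4)
      have h8 : |inner ℝ v (Xh i - P i)| ≤ 2 * C * h ^ 2 :=
        (abs_real_inner_le_norm _ _).trans (by gcongr; exact (hα i).trans hα₄)
      refine (abs_sub _ _).trans ?_
      have h9 := abs_add_le (inner ℝ v (P i - x - t)) (inner ℝ v (Xh i - P i))
      have h10 := h3.trans h4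
      linarith
    have hexp : ∑ i, llWeight K h x Xh d φ i * G i - g₀ =
        ∑ i, llWeight K h x Xh d φ i * (G i - (g₀ + inner ℝ v (Xh i - x))) := by
      conv_lhs => rw [← hrep g₀ v hv, ← Finset.sum_sub_distrib]
      exact Finset.sum_congr rfl fun i _ => by ring
    rw [hexp]
    calc |∑ i, llWeight K h x Xh d φ i * (G i - (g₀ + inner ℝ v (Xh i - x)))|
        ≤ ∑ i, |llWeight K h x Xh d φ i * (G i - (g₀ + inner ℝ v (Xh i - x)))| :=
          Finset.abs_sum_le_sum_abs _ _
      _ ≤ ∑ i, |llWeight K h x Xh d φ i| *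
          ((C * (R + 1) ^ 2 * (1 + 2 * C) + 2 * C) * h ^ 2) := by
          refine Finset.sum_le_sum fun i _ => ?_
          rw [abs_mul]
          by_cases hi : ω i = 0
          · have h1 := hwb i
            have h2 : K (‖x - Xh i‖ / h) / h ^ d = 0 := hi
            rw [h2, zero_mul] at h1
            rw [le_antisymm h1 (abs_nonneg _), zero_mul, zero_mul]
          · gcongr
            exact hres i hi
      _ = (∑ i, |llWeight K h x Xh d φ i|) *
          ((C * (R + 1) ^ 2 * (1 + 2 * C) + 2 * C) * h ^ 2) := by rw [Finset.sum_mul]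
      _ ≤ L * ((C * (R + 1) ^ 2 * (1 + 2 * C) + 2 * C) * h ^ 2) := by gcongr
      _ = _ := by ring

end RegularSample

section Measurability

theorem measurable_matrix_det {α k : Type*} {mα : MeasurableSpace α} [Fintype k] [DecidableEq k]
    {A : α → Matrix k k ℝ} (hA : ∀ i j, Measurable fun a => A a i j) :
    Measurable fun a => (A a).det := by
  simp only [Matrix.det_apply]
  exact Finset.measurable_sum _ fun σ _ =>
    (Finset.measurable_prod _ fun i _ => hA _ _).const_smul _

theorem measurable_matrix_inv {α k : Type*} {mα : MeasurableSpace α} [Fintype k] [DecidableEq k]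
    {A : α → Matrix k k ℝ} (hA : ∀ i j, Measurable fun a => A a i j) (i j : k) :
    Measurable fun a => (A a)⁻¹ i j := by
  simp only [Matrix.inv_def, Ring.inverse_eq_inv', Matrix.smul_apply, smul_eq_mul,
    Matrix.adjugate_apply]
  refine (measurable_matrix_det hA).inv.mul (measurable_matrix_det fun k l => ?_)
  by_cases hk : k = j
  · subst hk; simp only [Matrix.updateRow_self]; exact measurable_const
  · simp only [Matrix.updateRow_ne hk]; exact hA k l

theorem measurable_matrix_mul {α k l m : Type*} {mα : MeasurableSpace α} [Fintype l]
    {A : α → Matrix k l ℝ} {B : α → Matrix l m ℝ} (hA : ∀ i j, Measurable fun a => A a i j)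
    (hB : ∀ i j, Measurable fun a => B a i j) (i : k) (j : m) :
    Measurable fun a => (A a * B a) i j := by
  simp only [Matrix.mul_apply]
  exact Finset.measurable_sum _ fun t _ => (hA i t).mul (hB t j)

theorem measurable_llWeight {H α : Type*} {mα : MeasurableSpace α} [NormedAddCommGroup H]
    [InnerProductSpace ℝ H] [MeasurableSpace H] [BorelSpace H] [SecondCountableTopology H] {n : ℕ}
    {K : ℝ → ℝ} (hK : Measurable K) (h : ℝ) (x : H) {Xh : α → Fin n → H} (m : ℕ)
    {φ : ℕ → α → H} (hXh : ∀ i, Measurable fun a => Xh a i) (hφ : ∀ k, Measurable (φ k))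
    (i : Fin n) : Measurable fun a => llWeight K h x (Xh a) m (fun k => φ k a) i := by
  have hA : ∀ i j, Measurable fun a => designMatrix x (Xh a) m (fun k => φ k a) i j := by
    intro i j
    refine Fin.cases ?_ (fun k => ?_) j
    · simp only [designMatrix, Matrix.of_apply, Fin.cons_zero]; exact measurable_const
    · simp only [designMatrix, Matrix.of_apply, Fin.cons_succ]
      exact ((hXh i).sub_const x).inner (hφ k)
  have hW : ∀ i j, Measurable fun a => weightMatrix K h x (Xh a) m i j := by
    intro i j
    by_cases hij : i = j
    · subst hij
      simp only [weightMatrix, Matrix.diagonal_apply_eq]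
      exact (hK.comp (((hXh i).const_sub x).norm.div_const h)).div_const _
    · simp only [weightMatrix, Matrix.diagonal_apply_ne _ hij]; exact measurable_const
  have hT : ∀ i j, Measurable fun a => (designMatrix x (Xh a) m (fun k => φ k a)).transpose i j :=
    fun i j => hA j i
  exact measurable_matrix_mul (measurable_matrix_mul (measurable_matrix_inv
    (measurable_matrix_mul (measurable_matrix_mul hT hW) hA)) hT) hW 0 i

end Measurability

section Counting

theorem card_filter_eq_sum_indicator {Ω M : Type*} {X : ℕ → Ω → M} {n : ℕ} (S : Set M) (ω : Ω) [DecidablePred (· ∈ S)] :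
    (({i | X i ω ∈ S} : Finset (Fin n)).card : ℝ) =
      (∑ i : Fin n, fun ω => S.indicator (fun _ => (1 : ℝ)) (X i ω)) ω := by
  rw [Finset.sum_apply, Finset.card_filter, Nat.cast_sum]
  refine Finset.sum_congr rfl fun i _ => ?_
  by_cases h : X i ω ∈ S <;> simp [h]

variable {Ω M : Type*} [MeasurableSpace Ω] [MeasurableSpace M] {μ : Measure Ω}
  [IsProbabilityMeasure μ] {X : ℕ → Ω → M} {ν : Measure M}

/-- Chebyshev's inequality for the number of sample points in a set. -/
theorem measure_abs_card_sub_ge_le (hX : ∀ i, Measurable (X i)) (hind : iIndepFun X μ)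
    (hν : ∀ i, μ.map (X i) = ν) {S : Set M} [DecidablePred (· ∈ S)] (hS : MeasurableSet S) (n : ℕ)
    {t : ℝ} (ht : 0 < t) :
    μ {ω | t ≤ |(({i | X i ω ∈ S} : Finset (Fin n)).card : ℝ) - n * ν.real S|} ≤
      ENNReal.ofReal (n * ν.real S / t ^ 2) := by
  set Z : Fin n → Ω → ℝ := fun i ω => S.indicator (fun _ => (1 : ℝ)) (X i ω) with hZ
  have hZm : ∀ i, Measurable (Z i) := fun i =>
    (measurable_const.indicator hS).comp (hX i)
  have hZb : ∀ i ω, ‖Z i ω‖ ≤ 1 := by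
    intro i ω
    by_cases h : X i ω ∈ S <;> simp [hZ, h]
  have hZ2 : ∀ i, MemLp (Z i) 2 μ := fun i =>
    MemLp.of_bound (hZm i).aestronglyMeasurable 1 (Eventually.of_forall (hZb i))
  have hZi : ∀ i, ∫ ω, Z i ω ∂μ = ν.real S := by
    intro i
    have h1 : Z i = (X i ⁻¹' S).indicator (fun _ => (1 : ℝ)) := by
      funext ω
      by_cases h : X i ω ∈ S <;> simp [hZ, h]
    rw [h1, integral_indicator_const _ (hX i hS), smul_eq_mul, mul_one, ← hν i,
      map_measureReal_apply (hX i) hS]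
  have hvar : Var[∑ i, Z i; μ] ≤ n * ν.real S := by
    rw [IndepFun.variance_sum (fun i _ => hZ2 i)]
    · calc ∑ i, Var[Z i; μ] ≤ ∑ _i : Fin n, ν.real S := by
            refine Finset.sum_le_sum fun i _ => ?_
            refine (variance_le_expectation_sq (hZm i).aestronglyMeasurable).trans (le_of_eq ?_)
            rw [← hZi i]
            congr 1
            funext ω
            by_cases h : X i ω ∈ S <;> simp [hZ, h]
        _ = n * ν.real S := by simp
    · intro i _ j _ hij
      exact (hind.indepFun (fun h => hij (Fin.ext h))).comp (measurable_const.indicator hS)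
        (measurable_const.indicator hS)
  have hmean : ∫ ω, (∑ i, Z i) ω ∂μ = n * ν.real S := by
    simp only [Finset.sum_apply]
    rw [integral_finsetSum _ fun i _ => (hZ2 i).integrable (by norm_num)]
    simp [hZi]
  have h1 := meas_ge_le_variance_div_sq (memLp_finsetSum' Finset.univ fun i _ => hZ2 i) ht
  rw [hmean] at h1
  refine le_trans (le_of_eq ?_) (h1.trans (ENNReal.ofReal_le_ofReal (by gcongr)))
  congr 1
  ext ω
  rw [mem_ofPred_eq, mem_ofPred_eq, card_filter_eq_sum_indicator S ω]

theorem measure_card_lt_le (hX : ∀ i, Measurable (X i)) (hind : iIndepFun X μ)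
    (hν : ∀ i, μ.map (X i) = ν) {S : Set M} [DecidablePred (· ∈ S)] (hS : MeasurableSet S) {n : ℕ}
    (hn : 0 < n) {q : ℝ} (hq : 0 < q) (hqS : q ≤ ν.real S) :
    μ {ω | (({i | X i ω ∈ S} : Finset (Fin n)).card : ℝ) < q / 2 * n} ≤
      ENNReal.ofReal (4 / (n * q)) := by
  have hn' : (0 : ℝ) < n := by exact_mod_cast hn
  have hp : 0 < ν.real S := hq.trans_le hqS
  have h1 := measure_abs_card_sub_ge_le hX hind hν hS n (t := n * ν.real S / 2) (by positivity)
  refine (measure_mono fun ω hω => ?_).trans (h1.trans (ENNReal.ofReal_le_ofReal ?_))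
  · rw [mem_ofPred_eq] at hω ⊢
    rw [abs_sub_comm]
    refine le_trans ?_ (le_abs_self _)
    have : q / 2 * n ≤ n * ν.real S / 2 := by nlinarith
    linarith
  · calc n * ν.real S / (n * ν.real S / 2) ^ 2 = 4 / (n * ν.real S) := by field_simp; norm_num
      _ ≤ 4 / (n * q) := by gcongr

theorem measure_lt_card_le (hX : ∀ i, Measurable (X i)) (hind : iIndepFun X μ)
    (hν : ∀ i, μ.map (X i) = ν) {S : Set M} [DecidablePred (· ∈ S)] (hS : MeasurableSet S) {n : ℕ}
    (hn : 0 < n) {q : ℝ} (hq : 0 < q) (hqS : ν.real S ≤ q) :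
    μ {ω | 2 * q * n < (({i | X i ω ∈ S} : Finset (Fin n)).card : ℝ)} ≤
      ENNReal.ofReal (1 / (n * q)) := by
  have hn' : (0 : ℝ) < n := by exact_mod_cast hn
  have h1 := measure_abs_card_sub_ge_le hX hind hν hS n (t := n * q) (by positivity)
  refine (measure_mono fun ω hω => ?_).trans (h1.trans (ENNReal.ofReal_le_ofReal ?_))
  · rw [mem_ofPred_eq] at hω ⊢
    refine le_trans ?_ (le_abs_self _)
    have : n * ν.real S ≤ n * q := by gcongr
    linarith
  · calc n * ν.real S / (n * q) ^ 2 ≤ n * q / (n * q) ^ 2 := by gcongr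
      _ = 1 / (n * q) := by field_simp

end Counting

section Conditional

variable {Ω : Type*} {m mΩ : MeasurableSpace Ω} {μ : Measure Ω} [IsProbabilityMeasure μ]

/-- Markov's inequality for a conditional expectation on an event `D`, by integrating over a
smaller event `F` of the conditioning σ-algebra. -/
theorem measure_indicator_condLExp_gt_le (hm : m ≤ mΩ) (Z : Ω → ℝ≥0∞)
    {D F : Set Ω} (hF : MeasurableSet[m] F) {t : ℝ} (ht : 0 < t) :
    μ {ω | ENNReal.ofReal t < D.indicator (condLExp m μ Z) ω} ≤
      μ (D \ F) + (∫⁻ ω in F, Z ω ∂μ) / ENNReal.ofReal t := by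
  have h1 : {ω | ENNReal.ofReal t < D.indicator (condLExp m μ Z) ω} ⊆
      (D \ F) ∪ ({ω | ENNReal.ofReal t ≤ condLExp m μ Z ω} ∩ F) := by
    intro ω hω
    rw [mem_ofPred_eq] at hω
    by_cases hD : ω ∈ D
    · rw [indicator_of_mem hD] at hω
      by_cases hF' : ω ∈ F
      · exact Or.inr ⟨hω.le, hF'⟩
      · exact Or.inl ⟨hD, hF'⟩
    · rw [indicator_of_notMem hD] at hω
      exact absurd hω (by simp)
  refine (measure_mono h1).trans ((measure_union_le _ _).trans ?_)
  gcongr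
  have h2 : Measurable (condLExp m μ Z) := measurable_condLExp' _ _ _
  rw [← Measure.restrict_apply (measurableSet_le measurable_const h2)]
  refine (meas_ge_le_lintegral_div h2.aemeasurable (by simpa using ht) ENNReal.ofReal_ne_top).trans
    ?_
  rw [setLIntegral_condLExp hm μ Z hF]

/-- The conditional variance of a weighted sum of independent centered errors. -/
theorem lintegral_sq_sum_mul_le (hm : m ≤ mΩ) {n : ℕ}
    {e u : Fin n → Ω → ℝ} {σ V : ℝ} (he : ∀ i, Measurable (e i)) (he2 : ∀ i, MemLp (e i) 2 μ)
    (he0 : ∀ i, ∫ ω, e i ω ∂μ = 0) (heσ : ∀ i, ∫ ω, e i ω ^ 2 ∂μ = σ)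
    (hee : ∀ i j, i ≠ j → IndepFun (e i) (e j) μ)
    (hem : Indep (MeasurableSpace.comap (fun ω i => e i ω) inferInstance) m μ)
    (hu : ∀ i, Measurable[m] (u i)) (huV : ∀ ω, ∑ i, u i ω ^ 2 ≤ V) :
    ∫⁻ ω, ENNReal.ofReal ((∑ i, u i ω * e i ω) ^ 2) ∂μ ≤ ENNReal.ofReal (σ * V) := by
  rcases Nat.eq_zero_or_pos n with hn | hn
  · subst hn
    simp
  have hu' : ∀ i, Measurable (u i) := fun i => (hu i).mono hm le_rfl
  have hub : ∀ i ω, u i ω ^ 2 ≤ V := fun i ω =>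
    (Finset.single_le_sum (f := fun i => u i ω ^ 2) (fun j _ => sq_nonneg _)
      (Finset.mem_univ i)).trans (huV ω)
  have huub : ∀ i j ω, ‖u i ω * u j ω‖ ≤ V := by
    intro i j ω
    rw [Real.norm_eq_abs, abs_mul]
    have h1 := hub i ω
    have h2 := hub j ω
    rw [← sq_abs] at h1 h2
    nlinarith [sq_nonneg (|u i ω| - |u j ω|)]
  have huu : ∀ i j, Integrable (fun ω => u i ω * u j ω) μ := fun i j =>
    Integrable.of_bound ((hu' i).mul (hu' j)).aestronglyMeasurable V
      (Eventually.of_forall (huub i j))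
  have heei : ∀ i j, Integrable (fun ω => e i ω * e j ω) μ := fun i j =>
    (he2 i).integrable_mul (he2 j)
  have hindep : ∀ i j, IndepFun (fun ω => u i ω * u j ω) (fun ω => e i ω * e j ω) μ := by
    intro i j
    rw [IndepFun_iff_Indep]
    refine indep_of_indep_of_le_left (indep_of_indep_of_le_right hem.symm ?_) ?_
    · have : (fun ω => e i ω * e j ω) =
          (fun v : Fin n → ℝ => v i * v j) ∘ (fun ω i => e i ω) := rfl
      rw [this, ← MeasurableSpace.comap_comp]
      exact MeasurableSpace.comap_mono
        ((measurable_pi_apply i).mul (measurable_pi_apply j)).comap_le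
    · exact ((hu i).mul (hu j)).comap_le
  have hint : ∀ i j, Integrable (fun ω => (u i ω * u j ω) * (e i ω * e j ω)) μ := fun i j =>
    (hindep i j).integrable_mul (huu i j) (heei i j)
  have hexp : (fun ω => (∑ i, u i ω * e i ω) ^ 2) =
      fun ω => ∑ i, ∑ j, (u i ω * u j ω) * (e i ω * e j ω) := by
    funext ω
    rw [sq, Finset.sum_mul_sum]
    exact Finset.sum_congr rfl fun i _ => Finset.sum_congr rfl fun j _ => by ring
  have hval : ∀ i j, ∫ ω, (u i ω * u j ω) * (e i ω * e j ω) ∂μ =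
      if i = j then (∫ ω, u i ω ^ 2 ∂μ) * σ else 0 := by
    intro i j
    rw [(hindep i j).integral_fun_mul_eq_mul_integral (huu i j).aestronglyMeasurable
      (heei i j).aestronglyMeasurable]
    split_ifs with hij
    · subst hij
      simp only [← sq]
      rw [heσ]
    · rw [(hee i j hij).integral_fun_mul_eq_mul_integral (he i).aestronglyMeasurable
        (he j).aestronglyMeasurable, he0 i, zero_mul, mul_zero]
  have hI : Integrable (fun ω => (∑ i, u i ω * e i ω) ^ 2) μ := by
    rw [hexp]
    exact integrable_finsetSum _ fun i _ => integrable_finsetSum _ fun j _ => hint i j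
  rw [← ofReal_integral_eq_lintegral_ofReal hI (Eventually.of_forall fun ω => sq_nonneg _)]
  apply ENNReal.ofReal_le_ofReal
  have hσ : 0 ≤ σ := by
    rw [← heσ ⟨0, hn⟩]; exact integral_nonneg fun ω => sq_nonneg _
  calc ∫ ω, (∑ i, u i ω * e i ω) ^ 2 ∂μ
      = ∑ i, ∑ j, ∫ ω, (u i ω * u j ω) * (e i ω * e j ω) ∂μ := by
        rw [hexp, integral_finsetSum _ fun i _ => integrable_finsetSum _ fun j _ => hint i j]
        exact Finset.sum_congr rfl fun i _ => integral_finsetSum _ fun j _ => hint i j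
    _ = ∑ i, (∫ ω, u i ω ^ 2 ∂μ) * σ := by simp [hval]
    _ = (∫ ω, ∑ i, u i ω ^ 2 ∂μ) * σ := by
        rw [← Finset.sum_mul, integral_finsetSum]
        intro i _
        simpa [sq] using huu i i
    _ ≤ V * σ := by
        gcongr
        calc ∫ ω, ∑ i, u i ω ^ 2 ∂μ ≤ ∫ _ω, V ∂μ := by
              refine integral_mono (integrable_finsetSum _ fun i _ => ?_) (integrable_const _) huV
              simpa [sq] using huu i i
          _ = V := by simp
    _ = σ * V := mul_comm _ _

end Conditional

section Kernel

/-- A smoothing kernel vanishes outside a bounded set, is bounded, and is bounded away from zero on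
an interval of positive length inside `(0, 1)`. -/
theorem IsSmoothingKernel.exists_bounds {K : ℝ → ℝ} (hK : IsSmoothingKernel K) :
    ∃ R k₀ k₁ r₁ r₂ s : ℝ, 0 ≤ R ∧ (∀ u, K u ≠ 0 → |u| ≤ R) ∧ 0 < k₀ ∧ (∀ u, K u ≤ k₁) ∧ 0 < s ∧
      0 < r₁ ∧ r₁ < r₂ ∧ r₂ < 1 ∧ ∀ u ∈ Icc (r₁ - s) (r₂ + s), k₀ ≤ K u := by
  have hc : Continuous K := hK.differentiable.continuous
  obtain ⟨R, hR⟩ := hK.compactSupport.isCompact.isBounded.subset_closedBall 0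
  obtain ⟨k₁, hk₁⟩ := hc.bounded_above_of_compact_support hK.compactSupport
  have hpos : ∃ u ∈ Ioo (0 : ℝ) 1, 0 < K u := by
    by_contra! hcon
    have h0 : ∀ u ∈ Ioo (0 : ℝ) 1, K u = 0 := fun u hu => le_antisymm (hcon u hu) (hK.nonneg u)
    have h1 : ∫ u in (0 : ℝ)..1, K u = 0 := by
      rw [intervalIntegral.integral_of_le zero_le_one, integral_Ioc_eq_integral_Ioo]
      exact setIntegral_eq_zero_of_forall_eq_zero h0
    have h2 : ∫ u in (-1 : ℝ)..0, K u = 0 := by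
      have h3 := intervalIntegral.integral_comp_neg (a := (0 : ℝ)) (b := 1) K
      simp only [hK.symm, neg_zero] at h3
      rw [← h3, h1]
    have h4 := intervalIntegral.integral_add_adjacent_intervals (hc.intervalIntegrable (-1) 0)
      (hc.intervalIntegrable (μ := volume) 0 1)
    rw [h1, h2, hK.mass] at h4
    norm_num at h4
  obtain ⟨u, hu, hKu⟩ := hpos
  have hev : ∀ᶠ v in 𝓝 u, K u / 2 < K v :=
    hc.continuousAt.eventually (eventually_gt_nhds (by linarith))
  obtain ⟨η, hη, hηK⟩ := Metric.eventually_nhds_iff.1 hev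
  set s := min (η / 4) (min (u / 4) ((1 - u) / 4)) with hs
  have hs0 : 0 < s := by
    have := hu.1; have := hu.2
    rw [hs]
    refine lt_min (by linarith) (lt_min (by linarith) (by linarith))
  have hs1 : s ≤ η / 4 := min_le_left _ _
  have hs2 : s ≤ u / 4 := (min_le_right _ _).trans (min_le_left _ _)
  have hs3 : s ≤ (1 - u) / 4 := (min_le_right _ _).trans (min_le_right _ _)
  refine ⟨max R 0, K u / 2, k₁, u - s, u + s, s, le_max_right _ _, ?_, by linarith,
    fun v => (le_abs_self _).trans (hk₁ v), hs0, by linarith [hu.1], by linarith,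
    by linarith [hu.2], ?_⟩
  · intro v hv
    have := hR (subset_tsupport K hv)
    rw [mem_closedBall_zero_iff, Real.norm_eq_abs] at this
    exact this.trans (le_max_left _ _)
  · intro v hv
    refine (hηK ?_).le
    rw [Real.dist_eq, abs_lt]
    constructor <;> linarith [hv.1, hv.2]

end Kernel

section Contamination

variable {Ω M H : Type*} [MeasurableSpace Ω] [MeasurableSpace M] {μ : Measure Ω}
  [IsProbabilityMeasure μ] [NormedAddCommGroup H] [MeasurableSpace H] [BorelSpace H]

/-- A moment bound on the contamination gives a bound on the largest contamination. -/
theorem measure_exists_contamination_gt_le {n : ℕ} {Z : Fin n → Ω → H}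
    (hZ : ∀ i, Measurable (Z i)) {X : Fin n → Ω → M} (hX : ∀ i, Measurable (X i)) {η : M → ℝ}
    (hη : Measurable η) (hη0 : ∀ z, 0 ≤ η z) {p b A α : ℝ} (hp : 0 < p) (hb : 0 ≤ b)
    (hα : 0 < α) (hA : ∀ i, ∫⁻ ω, ENNReal.ofReal (η (X i ω) ^ p) ∂μ ≤ ENNReal.ofReal A)
    (hcond : ∀ i, ∀ᵐ ω ∂μ, (condLExp (MeasurableSpace.comap (X i) inferInstance) μ
      (fun ω' => ‖Z i ω'‖ₑ ^ p) ω) ^ (1 / p) ≤ ENNReal.ofReal (b * η (X i ω))) :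
    μ {ω | ∃ i, α < ‖Z i ω‖} ≤ ENNReal.ofReal (n * (b ^ p * A / α ^ p)) := by
  have hone : ∀ i, μ {ω | α < ‖Z i ω‖} ≤ ENNReal.ofReal (b ^ p * A / α ^ p) := by
    intro i
    have h1 : ∫⁻ ω, ‖Z i ω‖ₑ ^ p ∂μ ≤ ENNReal.ofReal (b ^ p * A) := by
      rw [← lintegral_condLExp (hX i).comap_le μ]
      calc ∫⁻ ω, (condLExp (MeasurableSpace.comap (X i) inferInstance) μ
            (fun ω' => ‖Z i ω'‖ₑ ^ p) ω) ∂μ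
          ≤ ∫⁻ ω, ENNReal.ofReal (b ^ p) * ENNReal.ofReal (η (X i ω) ^ p) ∂μ := by
            refine lintegral_mono_ae ?_
            filter_upwards [hcond i] with ω hω
            have h2 := ENNReal.rpow_le_rpow hω hp.le
            rw [← ENNReal.rpow_mul, one_div, inv_mul_cancel₀ hp.ne', ENNReal.rpow_one,
              ENNReal.ofReal_rpow_of_nonneg (mul_nonneg hb (hη0 _)) hp.le,
              Real.mul_rpow hb (hη0 _), ENNReal.ofReal_mul (by positivity)] at h2
            exact h2
        _ = ENNReal.ofReal (b ^ p) * ∫⁻ ω, ENNReal.ofReal (η (X i ω) ^ p) ∂μ := by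
            rw [lintegral_const_mul]
            exact ((hη.comp (hX i)).pow_const p).ennreal_ofReal
        _ ≤ ENNReal.ofReal (b ^ p) * ENNReal.ofReal A := by gcongr; exact hA i
        _ = _ := by rw [← ENNReal.ofReal_mul (by positivity)]
    have h2 : {ω | α < ‖Z i ω‖} ⊆ {ω | ENNReal.ofReal (α ^ p) ≤ ‖Z i ω‖ₑ ^ p} := by
      intro ω hω
      rw [mem_ofPred_eq] at hω ⊢
      rw [← ofReal_norm, ENNReal.ofReal_rpow_of_nonneg (norm_nonneg _) hp.le]
      exact ENNReal.ofReal_le_ofReal (Real.rpow_le_rpow hα.le hω.le hp.le)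
    have hαp : 0 < α ^ p := Real.rpow_pos_of_pos hα p
    refine (measure_mono h2).trans ((meas_ge_le_lintegral_div
      ((hZ i).enorm.pow_const p).aemeasurable (by simpa using hαp) ENNReal.ofReal_ne_top).trans ?_)
    rw [ENNReal.ofReal_div_of_pos hαp]
    gcongr
  have h3 : {ω | ∃ i, α < ‖Z i ω‖} = ⋃ i, {ω | α < ‖Z i ω‖} := by ext ω; simp
  rw [h3]
  refine (measure_iUnion_fintype_le _ _).trans ((Finset.sum_le_sum fun i _ => hone i).trans ?_)
  rw [Finset.sum_const, Finset.card_univ, Fintype.card_fin, nsmul_eq_mul,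
    ENNReal.ofReal_mul (by positivity), ENNReal.ofReal_natCast]

end Contamination

section Continuity

theorem TwiceDiffBounded.continuous {d : ℕ} [NeZero d] {M : Type*} [TopologicalSpace M]
    [ChartedSpace (EuclideanHalfSpace d) M] {g : M → ℝ} (hg : TwiceDiffBounded d g) :
    Continuous g := by
  rw [continuous_iff_continuousAt]
  intro x
  obtain ⟨B, hB⟩ := hg x
  have h1 := (hB.self_of_nhdsWithin (mem_range_self _)).1.continuousWithinAt
  have h2 : Tendsto (extChartAt (𝓡∂ d) x) (𝓝 x) (𝓝[range (𝓡∂ d)] (extChartAt (𝓡∂ d) x x)) :=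
    tendsto_nhdsWithin_iff.2 ⟨continuousAt_extChartAt x,
      Eventually.of_forall fun y => mem_range_self _⟩
  have h3 := h1.tendsto.comp h2
  have h4 : ((g ∘ (extChartAt (𝓡∂ d) x).symm) ∘ extChartAt (𝓡∂ d) x) =ᶠ[𝓝 x] g := by
    filter_upwards [extChartAt_source_mem_nhds (I := 𝓡∂ d) x] with y hy
    simp only [Function.comp_apply, (extChartAt (𝓡∂ d) x).left_inv hy]
  have h5 := h3.congr' h4
  rwa [Function.comp_apply, extChartAt_to_inv] at h5

end Continuity

section SampleSpread

variable {Ω M H : Type*} [MeasurableSpace Ω] [MeasurableSpace M] {μ : Measure Ω}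
  [IsProbabilityMeasure μ] [NormedAddCommGroup H] [InnerProductSpace ℝ H] [MeasurableSpace H]
  [BorelSpace H]

/-- With high probability the sample is well spread around `x` and not concentrated at `x`, at the
scale `h`. -/
theorem LocalGeometry.exists_bad_event {d : ℕ} {ι : M → H} (hι : Measurable ι) {ν ν' : Measure M}
    [IsProbabilityMeasure ν'] {g : M → ℝ} {r₁ r₂ c C h₀ cf Cf κ h : ℝ} {x : M} {T : Submodule ℝ H}
    {γ : H} (hgeo : LocalGeometry d ι ν g r₁ r₂ c C h₀ x T γ) (hc : 0 < c) (hC : 0 < C)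
    (hcf : 0 < cf) (hCf : 0 < Cf) (hκ : 1 ≤ κ)
    (hlow : ∀ S, MeasurableSet S → ENNReal.ofReal cf * ν S ≤ ν' S)
    (hupp : ∀ S, MeasurableSet S → ν' S ≤ ENNReal.ofReal Cf * ν S)
    {X : ℕ → Ω → M} (hX : ∀ i, Measurable (X i)) (hind : iIndepFun X μ)
    (hν : ∀ i, μ.map (X i) = ν') {n : ℕ} (hn : 0 < n) (hh : 0 < h) (hh₀ : κ * h < h₀) :
    ∃ B : Set Ω, μ B ≤ ENNReal.ofReal
        ((2 * d * (4 / (cf * c)) + 1 / (Cf * C * κ ^ d)) / (n * h ^ d)) ∧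
      ∀ ω ∉ B, WellSpread d T (ι x) (fun i : Fin n => ι (X i ω)) r₁ r₂ c (cf * c / 2) h ∧
        (({i | ‖ι (X i ω) - ι x‖ ≤ κ * h} : Finset (Fin n)).card : ℝ) ≤
          2 * (Cf * C * κ ^ d) * n * h ^ d := by
  classical
  have hn' : (0 : ℝ) < n := by exact_mod_cast hn
  have hκ0 : 0 < κ := by linarith
  obtain ⟨S, hSm, hSv, hSr, hSa⟩ := hgeo.cells h hh (lt_of_le_of_lt (by nlinarith) hh₀)
  set U : Set M := {y | ‖ι y - ι x‖ ≤ κ * h} with hU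
  have hUm : MeasurableSet U := measurableSet_le (hι.sub_const _).norm measurable_const
  have hUv : ν'.real U ≤ Cf * C * κ ^ d * h ^ d := by
    have h1 := (hupp U hUm).trans
      (mul_le_mul_right (hgeo.vol_le (κ * h) (by positivity) hh₀) (ENNReal.ofReal Cf))
    rw [← ENNReal.ofReal_mul hCf.le] at h1
    have h2 := ENNReal.toReal_mono ENNReal.ofReal_ne_top h1
    rw [ENNReal.toReal_ofReal (by positivity)] at h2
    refine h2.trans (le_of_eq ?_)
    rw [mul_pow]; ring
  have hSv' : ∀ j, cf * c * h ^ d ≤ ν'.real (S j) := by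
    intro j
    have h1 := (mul_le_mul_right (hSv j) (ENNReal.ofReal cf)).trans (hlow _ (hSm j))
    rw [← ENNReal.ofReal_mul hcf.le] at h1
    have h2 := ENNReal.toReal_mono (measure_ne_top _ _) h1
    rw [ENNReal.toReal_ofReal (by positivity)] at h2
    refine le_trans (le_of_eq ?_) h2
    ring
  set B₁ : Fin d × Bool → Set Ω := fun j =>
    {ω | (({i | X i ω ∈ S j} : Finset (Fin n)).card : ℝ) < cf * c * h ^ d / 2 * n} with hB₁
  set B₂ : Set Ω := {ω | 2 * (Cf * C * κ ^ d * h ^ d) * n <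
    (({i | X i ω ∈ U} : Finset (Fin n)).card : ℝ)} with hB₂
  refine ⟨(⋃ j, B₁ j) ∪ B₂, ?_, ?_⟩
  · have e1 : μ (⋃ j, B₁ j) ≤ ENNReal.ofReal (2 * d * (4 / (n * (cf * c * h ^ d)))) := by
      refine (measure_iUnion_fintype_le _ _).trans ((Finset.sum_le_sum fun j _ =>
        measure_card_lt_le hX hind hν (hSm j) hn (by positivity) (hSv' j)).trans (le_of_eq ?_))
      rw [Finset.sum_const, Finset.card_univ, Fintype.card_prod, Fintype.card_fin,
        Fintype.card_bool, nsmul_eq_mul, ENNReal.ofReal_mul (by positivity)]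
      congr 1
      rw [ENNReal.ofReal_mul (by positivity), ENNReal.ofReal_natCast]
      push_cast
      rw [mul_comm, ENNReal.ofReal_ofNat]
    have e2 : μ B₂ ≤ ENNReal.ofReal (1 / (n * (Cf * C * κ ^ d * h ^ d))) :=
      measure_lt_card_le hX hind hν hUm hn (by positivity) hUv
    refine (measure_union_le _ _).trans ((add_le_add e1 e2).trans (le_of_eq ?_))
    rw [← ENNReal.ofReal_add (by positivity) (by positivity)]
    congr 1
    field_simp
  · intro ω hω
    simp only [mem_union, mem_iUnion, not_or, not_exists, hB₁, hB₂, mem_ofPred_eq, not_lt] at hω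
    constructor
    · intro a v hv
      obtain ⟨j, hj⟩ := hSa a v hv
      refine ⟨({i | X i ω ∈ S j} : Finset (Fin n)), le_trans (le_of_eq (by ring)) (hω.1 j), fun i hi => ?_⟩
      have hi' : X i ω ∈ S j := by simpa using hi
      exact ⟨(hSr j _ hi').1, (hSr j _ hi').2, hj _ hi'⟩
    · refine le_trans (le_of_eq ?_) (hω.2.trans (le_of_eq (by ring)))
      rfl

end SampleSpread

section MeanSquaredError

variable {Ω M H : Type*} [mΩ : MeasurableSpace Ω] [MeasurableSpace M] {μ : Measure Ω}
  [IsProbabilityMeasure μ] [NormedAddCommGroup H] [InnerProductSpace ℝ H] [MeasurableSpace H]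
  [BorelSpace H] [SecondCountableTopology H]

/-- Reduction of the conditional mean squared error to deterministic bounds on the weights. -/
theorem measure_condMSE_gt_le {X : ℕ → Ω → M} {Xhat : (n : ℕ) → Fin n → Ω → H} {e Y : ℕ → Ω → ℝ}
    {g : M → ℝ} (hX : ∀ i, Measurable (X i)) (hXhat : ∀ n i, Measurable (Xhat n i))
    (he : ∀ i, Measurable (e i)) (hee : iIndepFun e μ) (he2 : ∀ i, MemLp (e i) 2 μ)
    (he0 : ∀ i, ∫ ω, e i ω ∂μ = 0) {σ : ℝ} (heσ : ∀ i, ∫ ω, e i ω ^ 2 ∂μ = σ)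
    {n : ℕ} (heX : IndepFun (fun ω (i : Fin n) => e i ω) (pairs X Xhat n) μ)
    (hY : ∀ i ω, Y i ω = g (X i ω) + e i ω) (hg : Measurable g) {K : ℝ → ℝ} (hK : Measurable K)
    (h : ℝ) (x : H) (g₀ : ℝ) {dhat : Ω → ℕ} (hdhat : Measurable[pairsSigma X Xhat n] dhat)
    {φ : ℕ → Ω → H} (hφ : ∀ k, Measurable[pairsSigma X Xhat n] (φ k)) (d : ℕ) {V B t : ℝ}
    (hV : 0 ≤ V) (hσ : 0 ≤ σ) (ht : 0 < t) :
    μ {ω | ENNReal.ofReal t < {ω | dhat ω = d}.indicator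
        (condLExp (pairsSigma X Xhat n) μ fun ω => ENNReal.ofReal
          ((gHat K h x (fun i => Xhat n i ω) (fun i => Y i ω) (dhat ω) (fun k => φ k ω) - g₀) ^ 2))
        ω} ≤
      μ ({ω | dhat ω = d} \ {ω |
        ∑ i, llWeight K h x (fun i => Xhat n i ω) d (fun k => φ k ω) i ^ 2 ≤ V ∧
        |∑ i : Fin n, llWeight K h x (fun i => Xhat n i ω) d (fun k => φ k ω) i * g (X i ω) - g₀|
          ≤ B}) + ENNReal.ofReal ((2 * B ^ 2 + 2 * (σ * V)) / t) := by
  have hpair : Measurable (pairs X Xhat n) :=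
    measurable_pi_iff.2 fun i => (hX i).prodMk (hXhat n i)
  have hm : pairsSigma X Xhat n ≤ mΩ := hpair.comap_le
  have hpm : Measurable[pairsSigma X Xhat n] (pairs X Xhat n) := comap_measurable _
  have hXm : ∀ i : Fin n, Measurable[pairsSigma X Xhat n] (X i) := fun i =>
    (by fun_prop : Measurable fun p : Fin n → M × H => (p i).1).comp hpm
  have hXhm : ∀ i : Fin n, Measurable[pairsSigma X Xhat n] (Xhat n i) := fun i =>
    (by fun_prop : Measurable fun p : Fin n → M × H => (p i).2).comp hpm
  set w : Fin n → Ω → ℝ := fun i ω =>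
    llWeight K h x (fun i => Xhat n i ω) d (fun k => φ k ω) i with hw
  have hwm : ∀ i, Measurable[pairsSigma X Xhat n] (w i) := fun i =>
    measurable_llWeight (mα := pairsSigma X Xhat n) hK h x d hXhm hφ i
  set F : Set Ω := {ω | dhat ω = d} ∩ {ω | ∑ i, w i ω ^ 2 ≤ V ∧
    |∑ i : Fin n, w i ω * g (X i ω) - g₀| ≤ B} with hF
  have hFm : MeasurableSet[pairsSigma X Xhat n] F := by
    have h1 : Measurable[pairsSigma X Xhat n] fun ω => ∑ i, w i ω ^ 2 :=
      Finset.measurable_sum _ fun i _ => (hwm i).pow_const 2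
    have h2 : Measurable[pairsSigma X Xhat n] fun ω => |∑ i : Fin n, w i ω * g (X i ω) - g₀| :=
      (by fun_prop : Measurable fun r : ℝ => |r - g₀|).comp
        (Finset.measurable_sum _ fun i _ => (hwm i).mul (hg.comp (hXm i)))
    exact MeasurableSet.inter (hdhat (measurableSet_singleton d))
      (MeasurableSet.inter (h1 measurableSet_Iic) (h2 measurableSet_Iic))
  refine (measure_indicator_condLExp_gt_le hm _ hFm ht).trans ?_
  have hDF : {ω | dhat ω = d} \ F = {ω | dhat ω = d} \ {ω | ∑ i, w i ω ^ 2 ≤ V ∧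
    |∑ i : Fin n, w i ω * g (X i ω) - g₀| ≤ B} := by rw [hF, sdiff_self_inter]
  rw [hDF, ENNReal.ofReal_div_of_pos ht]
  gcongr
  set u : Fin n → Ω → ℝ := fun i => F.indicator (w i) with hu
  have hum : ∀ i, Measurable[pairsSigma X Xhat n] (u i) := fun i => (hwm i).indicator hFm
  have huV : ∀ ω, ∑ i, u i ω ^ 2 ≤ V := by
    intro ω
    by_cases hω : ω ∈ F
    · simp only [hu, indicator_of_mem hω]; exact hω.2.1
    · simpa [hu, indicator_of_notMem hω] using hV
  have hS := lintegral_sq_sum_mul_le (μ := μ) hm (e := fun i : Fin n => e i) (fun i => he i)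
    (fun i => he2 i) (fun i => he0 i) (fun i => heσ i)
    (fun i j hij => hee.indepFun fun h => hij (Fin.ext h))
    ((IndepFun_iff_Indep _ _ _).1 heX) hum huV
  have hptw : ∀ ω ∈ F, ENNReal.ofReal
      ((gHat K h x (fun i => Xhat n i ω) (fun i => Y i ω) (dhat ω) (fun k => φ k ω) - g₀) ^ 2) ≤
      ENNReal.ofReal (2 * B ^ 2) + 2 * ENNReal.ofReal ((∑ i, u i ω * e i ω) ^ 2) := by
    intro ω hω
    have h1 : dhat ω = d := hω.1
    have h2 := hω.2.2
    rw [show (2 : ℝ≥0∞) = ENNReal.ofReal 2 by simp, ← ENNReal.ofReal_mul (by norm_num),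
      ← ENNReal.ofReal_add (by positivity) (by positivity)]
    apply ENNReal.ofReal_le_ofReal
    rw [h1, gHat_eq_sum_llWeight]
    simp only [hu, indicator_of_mem hω]
    have h3 : ∑ i : Fin n, llWeight K h x (fun i => Xhat n i ω) d (fun k => φ k ω) i * Y i ω - g₀ =
        (∑ i : Fin n, w i ω * g (X i ω) - g₀) + ∑ i : Fin n, w i ω * e i ω := by
      simp only [hY, mul_add, Finset.sum_add_distrib, hw]
      ring
    rw [h3]
    have h4 : (∑ i : Fin n, w i ω * g (X i ω) - g₀) ^ 2 ≤ B ^ 2 := by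
      rw [← sq_abs]; gcongr
    nlinarith [sq_nonneg ((∑ i : Fin n, w i ω * g (X i ω) - g₀) - ∑ i : Fin n, w i ω * e i ω)]
  calc ∫⁻ ω in F, ENNReal.ofReal
        ((gHat K h x (fun i => Xhat n i ω) (fun i => Y i ω) (dhat ω) (fun k => φ k ω) - g₀) ^ 2) ∂μ
      ≤ ∫⁻ ω in F, (ENNReal.ofReal (2 * B ^ 2) +
          2 * ENNReal.ofReal ((∑ i, u i ω * e i ω) ^ 2)) ∂μ :=
        setLIntegral_mono_ae' (hm _ hFm) (Eventually.of_forall hptw)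
    _ ≤ ∫⁻ ω, (ENNReal.ofReal (2 * B ^ 2) +
          2 * ENNReal.ofReal ((∑ i, u i ω * e i ω) ^ 2)) ∂μ := setLIntegral_le_lintegral _ _
    _ = ENNReal.ofReal (2 * B ^ 2) +
          2 * ∫⁻ ω, ENNReal.ofReal ((∑ i, u i ω * e i ω) ^ 2) ∂μ := by
        rw [lintegral_add_left measurable_const, lintegral_const_mul' _ _ (by simp)]
        simp
    _ ≤ ENNReal.ofReal (2 * B ^ 2) + 2 * ENNReal.ofReal (σ * V) := by gcongr
    _ = ENNReal.ofReal (2 * B ^ 2 + 2 * (σ * V)) := by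
        rw [ENNReal.ofReal_add (by positivity) (by positivity),
          ENNReal.ofReal_mul (p := 2) (q := σ * V) (by norm_num)]
        simp

end MeanSquaredError

section Rates

theorem tendsto_natCast_rpow_neg {y : ℝ} (hy : 0 < y) :
    Tendsto (fun n : ℕ => (n : ℝ) ^ (-y)) atTop (𝓝 0) :=
  (tendsto_rpow_neg_atTop hy).comp tendsto_natCast_atTop_atTop

variable {a : ℕ → ℝ} {s : ℝ}

theorem Asymp.eventually_pos (ha : Asymp a fun n => (n : ℝ) ^ (-s)) : ∀ᶠ n in atTop, 0 < a n := by
  obtain ⟨c, C, hc, hC, h⟩ := ha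
  filter_upwards [h, eventually_gt_atTop 0] with n hn hn0
  have hn' : (0 : ℝ) < n := by exact_mod_cast hn0
  exact lt_of_lt_of_le (by positivity) hn.1

theorem Asymp.exists_pow_le (ha : Asymp a fun n => (n : ℝ) ^ (-s)) (k : ℕ) :
    ∃ D : ℝ, 0 < D ∧ ∀ᶠ n : ℕ in atTop, a n ^ k ≤ D * (n : ℝ) ^ (-(s * k)) := by
  have hpos := ha.eventually_pos
  obtain ⟨c, C, hc, hC, h⟩ := ha
  refine ⟨C ^ k, by positivity, ?_⟩
  filter_upwards [h, hpos] with n hn hp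
  calc a n ^ k ≤ (C * (n : ℝ) ^ (-s)) ^ k := by gcongr; exact hn.2
    _ = _ := by rw [mul_pow, ← Real.rpow_mul_natCast (by positivity), neg_mul]

theorem Asymp.exists_div_pow_le (ha : Asymp a fun n => (n : ℝ) ^ (-s)) (t : ℝ) (k : ℕ) :
    ∃ D : ℝ, 0 < D ∧ ∀ᶠ n : ℕ in atTop,
      (n : ℝ) ^ (-t) / a n ^ k ≤ D * (n : ℝ) ^ (-(t - s * k)) := by
  obtain ⟨c, C, hc, hC, h⟩ := ha
  refine ⟨(c ^ k)⁻¹, by positivity, ?_⟩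
  filter_upwards [h, eventually_gt_atTop 0] with n hn hn0
  have hn' : (0 : ℝ) < n := by exact_mod_cast hn0
  calc (n : ℝ) ^ (-t) / a n ^ k ≤ (n : ℝ) ^ (-t) / (c * (n : ℝ) ^ (-s)) ^ k := by
        gcongr; exact hn.1
    _ = (c ^ k)⁻¹ * ((n : ℝ) ^ (-t) / (n : ℝ) ^ (-(s * k))) := by
        rw [mul_pow, ← Real.rpow_mul_natCast (by positivity), neg_mul]; field_simp
    _ = _ := by rw [← Real.rpow_sub hn']; congr 2; ring

theorem Asymp.tendsto_zero (ha : Asymp a fun n => (n : ℝ) ^ (-s)) (hs : 0 < s) :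
    Tendsto a atTop (𝓝 0) := by
  obtain ⟨D, hD, h⟩ := ha.exists_pow_le 1
  have h1 := (tendsto_natCast_rpow_neg hs).const_mul D
  rw [mul_zero] at h1
  refine squeeze_zero' (ha.eventually_pos.mono fun n hn => hn.le) ?_ h1
  filter_upwards [h] with n hn
  simpa using hn

theorem Asymp.tendsto_div_pow_zero (ha : Asymp a fun n => (n : ℝ) ^ (-s)) {t : ℝ} {k : ℕ}
    (hst : s * k < t) : Tendsto (fun n : ℕ => (n : ℝ) ^ (-t) / a n ^ k) atTop (𝓝 0) := by
  obtain ⟨D, hD, h⟩ := ha.exists_div_pow_le t k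
  have h1 := (tendsto_natCast_rpow_neg (sub_pos.2 hst)).const_mul D
  rw [mul_zero] at h1
  refine squeeze_zero' ?_ h h1
  filter_upwards [ha.eventually_pos] with n hn
  positivity

end Rates

section WeightBounds

variable {Ω M H : Type*} [MeasurableSpace Ω] [MeasurableSpace M] {μ : Measure Ω}
  [IsProbabilityMeasure μ] [NormedAddCommGroup H] [InnerProductSpace ℝ H] [MeasurableSpace H]
  [BorelSpace H]

/-- With probability tending to one, the local linear weights in the true dimension have squared sum
of order `(n h ^ d)⁻¹` and bias of order `h ^ 2`. -/
theorem exists_weight_bounds {d : ℕ} [NeZero d] {ι : M → H} (hι : Measurable ι) {ν ν' : Measure M}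
    [IsProbabilityMeasure ν'] {g : M → ℝ} {K : ℝ → ℝ} (hK : ∀ u, 0 ≤ K u)
    {R k₀ k₁ r₁ r₂ s : ℝ} (hR : 0 ≤ R)
    (hKR : ∀ u, K u ≠ 0 → |u| ≤ R) (hk₀ : 0 < k₀) (hk₁ : ∀ u, K u ≤ k₁) (hs : 0 < s)
    (hr₂ : r₂ < 1) (hKk : ∀ u ∈ Icc (r₁ - s) (r₂ + s), k₀ ≤ K u) {c C h₀ : ℝ} (hc : 0 < c)
    (hC : 0 < C) (hh₀ : 0 < h₀) (hgeo : ∀ x, ∃ T γ, LocalGeometry d ι ν g r₁ r₂ c C h₀ x T γ)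
    {cf Cf : ℝ} (hcf : 0 < cf) (hCf : 0 < Cf)
    (hlow : ∀ S, MeasurableSet S → ENNReal.ofReal cf * ν S ≤ ν' S)
    (hupp : ∀ S, MeasurableSet S → ν' S ≤ ENNReal.ofReal Cf * ν S)
    {X : ℕ → Ω → M} (hX : ∀ i, Measurable (X i)) (hind : iIndepFun X μ)
    (hν : ∀ i, μ.map (X i) = ν') {Xhat : (n : ℕ) → Fin n → Ω → H} {hpca hreg α u₀ : ℕ → ℝ}
    (hp : ∀ᶠ n in atTop, 0 < hpca n) (hp0 : Tendsto hpca atTop (𝓝 0))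
    (hpd : Tendsto (fun n : ℕ => (n : ℝ) ^ (-1 : ℝ) / hpca n ^ d) atTop (𝓝 0))
    (hr : ∀ᶠ n in atTop, 0 < hreg n) (hr0 : Tendsto hreg atTop (𝓝 0))
    (hrd : Tendsto (fun n : ℕ => (n : ℝ) ^ (-1 : ℝ) / hreg n ^ d) atTop (𝓝 0))
    (hαp : Tendsto (fun n => α n / hpca n ^ 1) atTop (𝓝 0))
    (hαr : Tendsto (fun n => α n / hreg n ^ 2) atTop (𝓝 0))
    (hu₀ : Tendsto u₀ atTop (𝓝 0))
    (hcont : ∀ᶠ n in atTop, μ {ω | ∃ i : Fin n, α n < ‖Xhat n i ω - ι (X i ω)‖} ≤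
      ENNReal.ofReal (u₀ n))
    (x : ℕ → M) {dhat : ℕ → Ω → ℕ} {φ : ℕ → ℕ → Ω → H}
    (hφ : ∀ n, ∀ᵐ ω ∂μ, IsTopEigenbasis (localCov (hpca n) (ι (x n)) fun i => Xhat n i ω)
      (dhat n ω) fun k => φ n k ω) :
    ∃ V₀ b₀ : ℝ, 0 ≤ V₀ ∧ 0 ≤ b₀ ∧ ∃ u : ℕ → ℝ, Tendsto u atTop (𝓝 0) ∧ ∀ᶠ n in atTop,
      μ ({ω | dhat n ω = d} \ {ω |
        ∑ i, llWeight K (hreg n) (ι (x n)) (fun i => Xhat n i ω) d (fun k => φ n k ω) i ^ 2 ≤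
          V₀ * ((n : ℝ) ^ (-1 : ℝ) / hreg n ^ d) ∧
        |∑ i : Fin n, llWeight K (hreg n) (ι (x n)) (fun i => Xhat n i ω) d (fun k => φ n k ω) i *
          g (X i ω) - g (x n)| ≤ b₀ * hreg n ^ 2}) ≤ ENNReal.ofReal (u n) := by
  set κ := R + 2 with hκ
  set c₁ := cf * c / 2 with hc₁
  set C₁ := 2 * (Cf * C * κ ^ d) with hC₁
  have hκ0 : 0 < κ := by linarith
  have hc₁0 : 0 < c₁ := by positivity
  have hC₁0 : 0 < C₁ := by positivity
  have hk₁0 : 0 ≤ k₁ := (hK 0).trans (hk₁ 0)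
  set A₀ := 2 * d * (4 / (cf * c)) + 1 / (Cf * C * κ ^ d) with hA₀
  set lam₀ := c₁ * k₀ * (c / 4) ^ 2 with hlam₀
  set L := k₁ * C₁ * (1 + R) / lam₀ with hL
  have hlam₀0 : 0 < lam₀ := by positivity
  have hL0 : 0 ≤ L := by positivity
  refine ⟨k₁ * (1 + R) / lam₀ * L, L * (C * (R + 1) ^ 2 * (1 + 2 * C) + 2 * C), by positivity,
    by positivity, fun n => |u₀ n| + |A₀ * ((n : ℝ) ^ (-1 : ℝ) / hpca n ^ d)| +
      |A₀ * ((n : ℝ) ^ (-1 : ℝ) / hreg n ^ d)|, ?_, ?_⟩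
  · have := (hu₀.abs.add (hpd.const_mul A₀).abs).add (hrd.const_mul A₀).abs
    simpa using this
  set θ : ℕ → ℝ := fun n =>
    d * (4 * (α n / hpca n + 4 * C * hpca n) / (c₁ / C₁ * (c ^ 2 / 4))) with hθ
  simp only [pow_one] at hαp
  have hθ0 : Tendsto θ atTop (𝓝 0) := by
    have := (((hαp.add (hp0.const_mul (4 * C))).const_mul 4).div_const
      (c₁ / C₁ * (c ^ 2 / 4))).const_mul (d : ℝ)
    simpa [hθ] using this
  have hκp : Tendsto (fun n => κ * hpca n) atTop (𝓝 0) := by simpa using hp0.const_mul κ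
  have hκr : Tendsto (fun n => κ * hreg n) atTop (𝓝 0) := by simpa using hr0.const_mul κ
  have hmin₁ : 0 < min (1 - r₂) (min (c / 2) 1) :=
    lt_min (by linarith) (lt_min (by positivity) one_pos)
  have hmin₂ : 0 < min s (min (c / 8) 1) := by positivity
  filter_upwards [hp, hr, eventually_gt_atTop 0, hκp.eventually_lt_const hh₀,
    hκr.eventually_lt_const hh₀, hαp.eventually_lt_const hmin₁,
    hαr.eventually_lt_const one_pos, hr0.eventually_lt_const hmin₂,
    hθ0.eventually_lt_const (show (0 : ℝ) < min (1 / 2) (c / 8) by positivity), hcont]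
    with n hp hr hn hkp hkr hap har hrs hθn hcn
  obtain ⟨T, γ, hG⟩ := hgeo (x n)
  have : FiniteDimensional ℝ T :=
    Module.finite_of_finrank_pos (by rw [hG.finrank_eq]; exact NeZero.pos d)
  have hn' : (0 : ℝ) < n := by exact_mod_cast hn
  obtain ⟨B₁, hB₁, hgood₁⟩ := hG.exists_bad_event hι hc hC hcf hCf (by linarith : 1 ≤ κ) hlow hupp
    hX hind hν hn hp hkp
  obtain ⟨B₂, hB₂, hgood₂⟩ := hG.exists_bad_event hι hc hC hcf hCf (by linarith : 1 ≤ κ) hlow hupp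
    hX hind hν hn hr hkr
  set B₃ : Set Ω := {ω | ∃ i : Fin n, α n < ‖Xhat n i ω - ι (X i ω)‖} with hB₃
  set N : Set Ω := {ω | ¬ IsTopEigenbasis (localCov (hpca n) (ι (x n)) fun i => Xhat n i ω)
      (dhat n ω) fun k => φ n k ω} with hN
  have hN0 : μ N = 0 := hφ n
  rw [div_lt_iff₀ hp] at hap
  rw [div_lt_iff₀ (by positivity), one_mul] at har
  have hrle : hreg n ^ 2 = hreg n * hreg n := sq _
  have hrs1 : hreg n ≤ s := hrs.le.trans (min_le_left _ _)
  have hrs2 : hreg n ≤ c / 8 := hrs.le.trans ((min_le_right _ _).trans (min_le_left _ _))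
  have hrs3 : hreg n ≤ 1 := hrs.le.trans ((min_le_right _ _).trans (min_le_right _ _))
  refine (measure_mono (t := ((N ∪ B₃) ∪ B₁) ∪ B₂) ?_).trans ?_
  · rintro ω ⟨hωd, hωb⟩
    by_contra hcon
    simp only [mem_union, not_or] at hcon
    obtain ⟨⟨⟨h1, h2⟩, h3⟩, h4⟩ := hcon
    have htop := not_not.1 h1
    rw [show dhat n ω = d from hωd] at htop
    have hα : ∀ i : Fin n, ‖Xhat n i ω - ι (X i ω)‖ ≤ α n := by
      intro i
      by_contra! hi
      exact h2 ⟨i, hi⟩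
    obtain ⟨g1, g2⟩ := hgood₁ ω h3
    obtain ⟨g3, g4⟩ := hgood₂ ω h4
    have hcnt : ∀ (ρ : ℝ) (h : ℝ), 0 < h → ρ ≤ κ →
        (({i | ‖ι (X i ω) - ι (x n)‖ ≤ κ * h} : Finset (Fin n)).card : ℝ) ≤ C₁ * n * h ^ d →
        (({i | ‖ι (X i ω) - ι (x n)‖ ≤ ρ * h} : Finset (Fin n)).card : ℝ) ≤ C₁ * n * h ^ d := by
      intro ρ h hh hρ hle
      refine le_trans ?_ hle
      refine Nat.cast_le.2 (Finset.card_le_card fun i hi => ?_)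
      simp only [Finset.mem_filter, Finset.mem_univ, true_and] at hi ⊢
      exact hi.trans (by gcongr)
    have hα0 : 0 ≤ α n := (norm_nonneg _).trans (hα ⟨0, hn⟩)
    have hαm : ∀ b, min (1 - r₂) (min (c / 2) 1) ≤ b → α n < b * hpca n := fun b hb =>
      hap.trans_le (by gcongr)
    have hθv : ∀ v ∈ Submodule.span ℝ (range fun k : Fin d => φ n k ω),
        ‖Tᗮ.starProjection v‖ ≤ θ n * ‖v‖ := fun v hv => orthogonal_le_of_wellSpread (v := v) hG.finrank_eq hn hp hc hc₁0 hC hC₁0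
      g1 (hcnt 2 _ hp (by linarith) g2) hα (hαm _ (min_le_left _ _))
      (hαm _ ((min_le_right _ _).trans (min_le_left _ _))).le
      (by simpa using (hαm 1 ((min_le_right _ _).trans (min_le_right _ _))).le)
      (fun i hi => by
        obtain ⟨t, ht, ht1, -⟩ := hG.tangent (X i ω) hi
        exact ⟨t, ht, ht1⟩)
      (lt_of_le_of_lt (by gcongr; linarith) hkp) htop hv
    have hb := llWeight_bounds (θ := θ n) (φ := fun k => φ n k ω) (γ := γ) (T := T)
      (P := fun i : Fin n => ι (X i ω)) (Xh := fun i => Xhat n i ω) (G := fun i : Fin n => g (X i ω)) (g₀ := g (x n)) hG.finrank_eq hn hr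
      hc hc₁0 hC hC₁0 hr₂.le hK hR hKR hk₀ hKk hk₁ g3 (hcnt (R + 1) _ hr (by linarith) g4) hα
      (har.le.trans (by rw [hrle]; gcongr)) (har.le.trans (by rw [hrle]; gcongr))
      (har.le.trans (by nlinarith)) har.le hG.mem hG.norm_le
      (fun i hi => hG.tangent (X i ω) hi) (lt_of_le_of_lt (by gcongr; linarith) hkr) htop.1
      hθv (hθn.le.trans (min_le_left _ _)) (hθn.le.trans (min_le_right _ _))
    obtain ⟨hb₁, hb₂⟩ := hb
    simp only [mem_ofPred_eq, not_and] at hωb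
    refine hωb (hb₁.trans (le_of_eq ?_)) hb₂
    have e : ∀ A : ℝ, A / (n * hreg n ^ d) = A * ((n : ℝ) ^ (-1 : ℝ) / hreg n ^ d) := by
      intro A
      rw [Real.rpow_neg_one]; field_simp
    rw [hL, hlam₀]
    exact e _
  · refine (measure_union_le _ _).trans ((add_le_add_left ((measure_union_le _ _).trans
      (add_le_add_left (measure_union_le _ _) _)) _).trans ?_)
    rw [hN0, zero_add]
    have e : ∀ h : ℝ, 0 < h →
        A₀ / (n * h ^ d) = A₀ * ((n : ℝ) ^ (-1 : ℝ) / h ^ d) := by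
      intro h hh
      rw [Real.rpow_neg_one]; field_simp
    rw [e _ hp] at hB₁
    rw [e _ hr] at hB₂
    rw [ENNReal.ofReal_add (by positivity) (abs_nonneg _),
      ENNReal.ofReal_add (abs_nonneg _) (abs_nonneg _)]
    exact add_le_add (add_le_add (hcn.trans (ENNReal.ofReal_le_ofReal (le_abs_self _)))
      (hB₁.trans (ENNReal.ofReal_le_ofReal (le_abs_self _))))
      (hB₂.trans (ENNReal.ofReal_le_ofReal (le_abs_self _)))

end WeightBounds

section MainTheorem

theorem exists_contamination_sequence {Ω M H : Type*} [MeasurableSpace Ω] [MeasurableSpace M]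
    {μ : Measure Ω} [IsProbabilityMeasure μ] [NormedAddCommGroup H] [SecondCountableTopology H]
    [MeasurableSpace H] [BorelSpace H] {ι : M → H} (hι : Measurable ι) {X : ℕ → Ω → M}
    {Xhat : (n : ℕ) → Fin n → Ω → H} (hX : ∀ i, Measurable (X i)) {ν : Measure M}
    (hν : ∀ i, μ.map (X i) = ν) (hXhat : ∀ n i, Measurable (Xhat n i)) {η : M → ℝ}
    (hη : Measurable η) (hη0 : ∀ z, 0 ≤ η z)
    (hηp : ∀ (i : ℕ) (p : ℝ), 1 ≤ p → Integrable (fun ω => η (X i ω) ^ p) μ) {C : ℝ → ℝ} {β : ℝ}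
    (hcontam : ∀ p : ℝ, 1 ≤ p → ∀ (n : ℕ) (i : Fin n), ∀ᵐ ω ∂μ,
      (condLExp (MeasurableSpace.comap (X i) inferInstance) μ
        (fun ω' => ‖Xhat n i ω' - ι (X i ω')‖ₑ ^ p) ω) ^ (1 / p) ≤
          ENNReal.ofReal (C p * (n : ℝ) ^ (-β) * η (X i ω))) {δ : ℝ} (hδ : 0 < δ) :
    ∃ u : ℕ → ℝ, Tendsto u atTop (𝓝 0) ∧ ∀ᶠ n : ℕ in atTop,
      μ {ω | ∃ i : Fin n, (n : ℝ) ^ (-(β - δ)) < ‖Xhat n i ω - ι (X i ω)‖} ≤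
        ENNReal.ofReal (u n) := by
  set p : ℝ := 2 / δ + 1 with hp
  have hp1 : 1 ≤ p := by rw [hp]; linarith [div_pos two_pos hδ]
  have hp0 : 0 < p := by linarith
  have hδp : δ * p = 2 + δ := by rw [hp]; field_simp
  set A := ∫ ω, η (X 0 ω) ^ p ∂μ with hA
  have hηm : Measurable fun z => η z ^ p := hη.pow_const p
  have hAi : ∀ i, ∫⁻ ω, ENNReal.ofReal (η (X i ω) ^ p) ∂μ ≤ ENNReal.ofReal A := by
    intro i
    have h1 : ∀ j, ∫⁻ ω, ENNReal.ofReal (η (X j ω) ^ p) ∂μ = ∫⁻ z, ENNReal.ofReal (η z ^ p) ∂ν :=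
      fun j => by rw [← hν j, lintegral_map hηm.ennreal_ofReal (hX j)]
    rw [h1 i, ← h1 0, ofReal_integral_eq_lintegral_ofReal (hηp 0 p hp1)
      (ae_of_all _ fun ω => Real.rpow_nonneg (hη0 _) _)]
  refine ⟨fun n => |C p| ^ p * A * (n : ℝ) ^ (-(1 + δ)), ?_, ?_⟩
  · simpa using (tendsto_natCast_rpow_neg (by linarith : 0 < 1 + δ)).const_mul (|C p| ^ p * A)
  · filter_upwards [eventually_gt_atTop 0] with n hn
    have hn' : (0 : ℝ) < n := by exact_mod_cast hn
    have h1 := measure_exists_contamination_gt_le (μ := μ) (b := |C p| * (n : ℝ) ^ (-β)) (A := A)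
      (α := (n : ℝ) ^ (-(β - δ))) (Z := fun (i : Fin n) ω => Xhat n i ω - ι (X i ω))
      (X := fun i => X i) (fun i => (hXhat n i).sub (hι.comp (hX i))) (fun i => hX i) hη hη0 hp0
      (by positivity) (by positivity) (fun i => hAi i) (fun i => by
        filter_upwards [hcontam p hp1 n i] with ω hω
        refine hω.trans (ENNReal.ofReal_le_ofReal ?_)
        have := hη0 (X i ω)
        gcongr
        exact le_abs_self _)
    refine h1.trans (le_of_eq (congrArg _ ?_))
    rw [Real.mul_rpow (abs_nonneg _) (by positivity), ← Real.rpow_mul hn'.le,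
      ← Real.rpow_mul hn'.le]
    have h2 : (n : ℝ) ^ (-(1 + δ)) = n * (n : ℝ) ^ (-β * p) / (n : ℝ) ^ (-(β - δ) * p) := by
      rw [show -(1 + δ) = 1 + -β * p - -(β - δ) * p by linarith, Real.rpow_sub hn',
        Real.rpow_add hn', Real.rpow_one]
    rw [h2]
    ring

/-- The squared bias and the variance are of the order of the rate of convergence. -/
theorem exists_rate_bound {d : ℕ} [NeZero d] {β ε : ℝ} (hε : 0 < ε) {h : ℕ → ℝ}
    (hh : Asymp h fun n =>
      (n : ℝ) ^ (-(if 3 / ((d : ℝ) + 4) < β then 1 / ((d : ℝ) + 4) else β / (3 + ε * d))))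
    {a b : ℝ} (ha : 0 ≤ a) (hb : 0 ≤ b) :
    ∃ D : ℝ, 0 < D ∧ ∀ᶠ n : ℕ in atTop, a * h n ^ 4 + b * ((n : ℝ) ^ (-1 : ℝ) / h n ^ d) ≤
      D * ((n : ℝ) ^ (-(4 / ((d : ℝ) + 4))) + (n : ℝ) ^ (-(4 * β / (3 + ε * d)))) := by
  obtain ⟨D₁, hD₁, h₁⟩ := hh.exists_pow_le 4
  obtain ⟨D₂, hD₂, h₂⟩ := hh.exists_div_pow_le 1 d
  set s := if 3 / ((d : ℝ) + 4) < β then 1 / ((d : ℝ) + 4) else β / (3 + ε * d) with hs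
  have hd : (0 : ℝ) < d := by exact_mod_cast NeZero.pos d
  have hs4 : s * (4 : ℕ) = 4 / ((d : ℝ) + 4) ∨ s * (4 : ℕ) = 4 * β / (3 + ε * d) := by
    rw [hs]
    split_ifs
    · left; push_cast; ring
    · right; push_cast; ring
  have hsle : s ≤ 1 / ((d : ℝ) + 4) := by
    rw [hs]
    split_ifs with hβ'
    · exact le_rfl
    · rw [not_lt, le_div_iff₀ (by positivity)] at hβ'
      rw [div_le_div_iff₀ (by positivity) (by positivity)]
      nlinarith [mul_pos hε hd]
  have hsd : 4 / ((d : ℝ) + 4) ≤ 1 - s * d := by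
    have : s * d ≤ 1 / ((d : ℝ) + 4) * d := by gcongr
    have e : 1 - 1 / ((d : ℝ) + 4) * d = 4 / ((d : ℝ) + 4) := by field_simp; ring
    linarith
  refine ⟨a * D₁ + b * D₂ + 1, by positivity, ?_⟩
  filter_upwards [h₁, h₂, eventually_ge_atTop 1] with n h₁ h₂ hn
  have hn' : (1 : ℝ) ≤ n := by exact_mod_cast hn
  have hn0 : (0 : ℝ) < n := by linarith
  set x := (n : ℝ) ^ (-(4 / ((d : ℝ) + 4))) with hx
  set y := (n : ℝ) ^ (-(4 * β / (3 + ε * d))) with hy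
  have hx0 : 0 < x := by positivity
  have hy0 : 0 < y := by positivity
  have e₁ : (n : ℝ) ^ (-(s * (4 : ℕ))) ≤ x + y := by
    rcases hs4 with h | h
    · rw [h]; linarith
    · rw [h]; linarith
  have e₂ : (n : ℝ) ^ (-(1 - s * d)) ≤ x + y := by
    have : (n : ℝ) ^ (-(1 - s * d)) ≤ x := Real.rpow_le_rpow_of_exponent_le hn' (by linarith)
    linarith
  calc a * h n ^ 4 + b * ((n : ℝ) ^ (-1 : ℝ) / h n ^ d)
      ≤ a * (D₁ * (x + y)) + b * (D₂ * (x + y)) := by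
        gcongr
        · exact h₁.trans (by gcongr)
        · exact h₂.trans (by gcongr)
    _ ≤ (a * D₁ + b * D₂ + 1) * (x + y) := by linarith

variable {d : ℕ} [NeZero d] {M H : Type*} [TopologicalSpace M]
  [ChartedSpace (EuclideanHalfSpace d) M] [IsManifold (𝓡∂ d) ((⊤ : ℕ∞) : WithTop ℕ∞) M]
  [CompactSpace M] [MeasurableSpace M] [BorelSpace M] [NormedAddCommGroup H]
  [InnerProductSpace ℝ H] [SecondCountableTopology H] [MeasurableSpace H] [BorelSpace H]
  {Ω : Type*} [MeasurableSpace Ω] {μ : Measure Ω} [IsProbabilityMeasure μ]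

/-- The rate of convergence of functional local linear manifold regression, for a manifold embedded
in any separable inner product space. -/
theorem isBigOP_condMSE {ι : M → H} (hι : IsEmbeddedManifold d ι) {X : ℕ → Ω → M}
    {Xhat : (n : ℕ) → Fin n → Ω → H} {e : ℕ → Ω → ℝ} {g : M → ℝ} {Y : ℕ → Ω → ℝ}
    (hX : ∀ i, Measurable (X i)) (hX_indep : iIndepFun X μ)
    (hXhat : ∀ n i, Measurable (Xhat n i))
    (he : ∀ i, Measurable (e i)) (he_indep : iIndepFun e μ)
    (he_ident : ∀ i j, IdentDistrib (e i) (e j) μ μ)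
    (he_sq : ∀ i, MemLp (e i) 2 μ) (he_mean : ∀ i, ∫ ω, e i ω ∂μ = 0)
    (he_X : ∀ n : ℕ, IndepFun (fun ω (i : Fin n) => e i ω) (pairs X Xhat n) μ)
    (hY : ∀ i ω, Y i ω = g (X i ω) + e i ω) {K : ℝ → ℝ} (hK : IsSmoothingKernel K)
    {f : M → ℝ} (hf_bdd : ∃ c₁ c₂ : ℝ, 0 < c₁ ∧ ∀ z, c₁ ≤ f z ∧ f z ≤ c₂)
    (hf_density : ∀ i, μ.map (X i) = (riemVol d ι).withDensity fun z => ENNReal.ofReal (f z))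
    (hg : TwiceDiffBounded d g) {β : ℝ} (hβ : 0 < β) {η : M → ℝ} (hη : Measurable η)
    (hη0 : ∀ z, 0 ≤ η z)
    (hηp : ∀ (i : ℕ) (p : ℝ), 1 ≤ p → Integrable (fun ω => η (X i ω) ^ p) μ) {C : ℝ → ℝ}
    (hcontam : ∀ p : ℝ, 1 ≤ p → ∀ (n : ℕ) (i : Fin n), ∀ᵐ ω ∂μ,
      (condLExp (MeasurableSpace.comap (X i) inferInstance) μ
        (fun ω' => ‖Xhat n i ω' - ι (X i ω')‖ₑ ^ p) ω) ^ (1 / p) ≤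
          ENNReal.ofReal (C p * (n : ℝ) ^ (-β) * η (X i ω)))
    {hpca hreg : ℕ → ℝ} {ε : ℝ} (hε : 0 < ε)
    (hhpca : Asymp hpca fun n =>
      (n : ℝ) ^ (-(if 2 / (d : ℝ) ≤ β then 1 / ((d : ℝ) + 2) else β / 2)))
    (hhreg : Asymp hreg fun n =>
      (n : ℝ) ^ (-(if 3 / ((d : ℝ) + 4) < β then 1 / ((d : ℝ) + 4) else β / (3 + ε * d))))
    (x : ℕ → M) {dhat : ℕ → Ω → ℕ} (hdhat : ∀ n, Measurable[pairsSigma X Xhat n] (dhat n))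
    {φ : ℕ → ℕ → Ω → H} (hφm : ∀ n k, Measurable[pairsSigma X Xhat n] (φ n k))
    (hφ : ∀ n, ∀ᵐ ω ∂μ,
      IsTopEigenbasis (localCov (hpca n) (ι (x n)) fun i => Xhat n i ω) (dhat n ω)
        fun k => φ n k ω) :
    IsBigOP μ
      (fun n => {ω | dhat n ω = d}.indicator
        (condLExp (pairsSigma X Xhat n) μ fun ω =>
          ENNReal.ofReal
            ((gHat K (hreg n) (ι (x n)) (fun i => Xhat n i ω) (fun i => Y i ω) (dhat n ω)
                (fun k => φ n k ω) - g (x n)) ^ 2)))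
      (fun n => (n : ℝ) ^ (-(4 / ((d : ℝ) + 4))) + (n : ℝ) ^ (-(4 * β / (3 + ε * d)))) := by
  have hd : (0 : ℝ) < d := by exact_mod_cast NeZero.pos d
  have hιm : Measurable ι := hι.embedding.continuous.measurable
  obtain ⟨R, k₀, k₁, r₁, r₂, s, hR, hKR, hk₀, hk₁, hs, hr₁, hr, hr₂, hKk⟩ := hK.exists_bounds
  obtain ⟨c, Cg, h₀, hc, hCg, hh₀, hgeo⟩ := hι.exists_localGeometry hg hr₁ hr
  have hprob : IsProbabilityMeasure
      ((riemVol d ι).withDensity fun z => ENNReal.ofReal (f z)) := by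
    rw [← hf_density 0]
    exact Measure.isProbabilityMeasure_map (hX 0).aemeasurable
  obtain ⟨cf, Cf, hcf, hf⟩ := hf_bdd
  have hCf : 0 < Cf := hcf.trans_le ((hf (x 0)).1.trans (hf (x 0)).2)
  have hlow : ∀ S, MeasurableSet S → ENNReal.ofReal cf * riemVol d ι S ≤
      (riemVol d ι).withDensity (fun z => ENNReal.ofReal (f z)) S := by
    intro S hS
    rw [withDensity_apply _ hS, ← setLIntegral_const]
    exact lintegral_mono fun z => ENNReal.ofReal_le_ofReal (hf z).1
  have hupp : ∀ S, MeasurableSet S →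
      (riemVol d ι).withDensity (fun z => ENNReal.ofReal (f z)) S ≤
        ENNReal.ofReal Cf * riemVol d ι S := by
    intro S hS
    rw [withDensity_apply _ hS, ← setLIntegral_const]
    exact lintegral_mono fun z => ENNReal.ofReal_le_ofReal (hf z).2
  have hrate := fun a b ha hb => exists_rate_bound hε hhreg (a := a) (b := b) ha hb
  set sp := if 2 / (d : ℝ) ≤ β then 1 / ((d : ℝ) + 2) else β / 2 with hsp
  set sr := if 3 / ((d : ℝ) + 4) < β then 1 / ((d : ℝ) + 4) else β / (3 + ε * d) with hsr
  have hsp0 : 0 < sp ∧ sp * d < 1 ∧ sp < β := by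
    rw [hsp]
    split_ifs with h
    · refine ⟨by positivity, ?_, lt_of_lt_of_le ?_ h⟩
      · rw [div_mul_eq_mul_div, div_lt_one (by positivity)]; linarith
      · rw [div_lt_div_iff₀ (by positivity) hd]; linarith
    · rw [not_le, lt_div_iff₀ hd] at h
      exact ⟨by positivity, by linarith, by linarith⟩
  have hsr0 : 0 < sr ∧ sr * d < 1 ∧ 2 * sr < β := by
    rw [hsr]
    split_ifs with h
    · refine ⟨by positivity, ?_, lt_of_le_of_lt ?_ h⟩
      · rw [div_mul_eq_mul_div, div_lt_one (by positivity)]; linarith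
      · rw [← mul_div_assoc, div_le_div_iff_of_pos_right (by positivity)]; linarith
    · rw [not_lt, le_div_iff₀ (by positivity)] at h
      have hεd : 0 < ε * d := by positivity
      refine ⟨by positivity, ?_, ?_⟩
      · rw [div_mul_eq_mul_div, div_lt_one (by positivity)]; linarith
      · rw [← mul_div_assoc, div_lt_iff₀ (by positivity)]
        nlinarith
  obtain ⟨hsp0, hspd, hspβ⟩ := hsp0
  obtain ⟨hsr0, hsrd, hsrβ⟩ := hsr0
  obtain ⟨δ, hδ, hδp, hδr⟩ : ∃ δ : ℝ, 0 < δ ∧ sp < β - δ ∧ 2 * sr < β - δ := by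
    refine ⟨min (β - sp) (β - 2 * sr) / 2, ?_, ?_, ?_⟩
    · have : 0 < min (β - sp) (β - 2 * sr) := lt_min (by linarith) (by linarith)
      linarith
    · linarith [min_le_left (β - sp) (β - 2 * sr)]
    · linarith [min_le_right (β - sp) (β - 2 * sr)]
  obtain ⟨u₀, hu₀, hcont⟩ := exists_contamination_sequence hιm hX hf_density hXhat hη hη0 hηp
    hcontam hδ
  obtain ⟨V₀, b₀, hV₀, hb₀, u, hu, hw⟩ := exists_weight_bounds (μ := μ) (g := g) (dhat := dhat)
    (φ := φ) (Xhat := Xhat) hιm hK.nonneg hR hKR hk₀ hk₁ hs hr₂ hKk hc hCg hh₀ hgeo hcf hCf hlow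
    hupp hX hX_indep hf_density hhpca.eventually_pos (hhpca.tendsto_zero hsp0)
    (hhpca.tendsto_div_pow_zero hspd) hhreg.eventually_pos (hhreg.tendsto_zero hsr0)
    (hhreg.tendsto_div_pow_zero hsrd)
    (hhpca.tendsto_div_pow_zero (t := β - δ) (k := 1) (by simpa using hδp))
    (hhreg.tendsto_div_pow_zero (t := β - δ) (k := 2) (by push_cast; linarith)) hu₀ hcont x hφ
  have heσ : ∀ i, ∫ ω, e i ω ^ 2 ∂μ = ∫ ω, e 0 ω ^ 2 ∂μ := fun i =>
    ((he_ident i 0).comp (u := fun t : ℝ => t ^ 2) (by fun_prop)).integral_eq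
  set σ := ∫ ω, e 0 ω ^ 2 ∂μ with hσ
  have hσ0 : 0 ≤ σ := integral_nonneg fun ω => sq_nonneg _
  obtain ⟨D, hD, hrate⟩ := hrate (2 * b₀ ^ 2) (2 * (σ * V₀)) (by positivity) (by positivity)
  intro δ' hδ'
  refine ⟨2 * D / δ', by positivity, ?_⟩
  filter_upwards [hrate, hw, hu.eventually_lt_const (half_pos hδ'), hhreg.eventually_pos,
    eventually_gt_atTop 0] with n hrn hwn hun hrp hn
  have hn' : (0 : ℝ) < n := by exact_mod_cast hn
  set r := (n : ℝ) ^ (-(4 / ((d : ℝ) + 4))) + (n : ℝ) ^ (-(4 * β / (3 + ε * d))) with hrdef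
  have hr0 : 0 < r := by positivity
  refine (measure_condMSE_gt_le hX hXhat he he_indep he_sq he_mean heσ (he_X n) hY
    hg.continuous.measurable hK.differentiable.continuous.measurable (hreg n) (ι (x n)) (g (x n))
    (hdhat n) (hφm n) d (V := V₀ * ((n : ℝ) ^ (-1 : ℝ) / hreg n ^ d)) (B := b₀ * hreg n ^ 2)
    (by positivity) hσ0 (by positivity)).trans ?_
  refine (add_le_add hwn (ENNReal.ofReal_le_ofReal (?_ : _ ≤ δ' / 2))).trans ?_
  · rw [div_le_iff₀ (by positivity)]
    calc 2 * (b₀ * hreg n ^ 2) ^ 2 + 2 * (σ * (V₀ * ((n : ℝ) ^ (-1 : ℝ) / hreg n ^ d)))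
        = 2 * b₀ ^ 2 * hreg n ^ 4 + 2 * (σ * V₀) * ((n : ℝ) ^ (-1 : ℝ) / hreg n ^ d) := by ring
      _ ≤ D * r := hrn
      _ = δ' / 2 * (2 * D / δ' * r) := by field_simp
  · calc ENNReal.ofReal (u n) + ENNReal.ofReal (δ' / 2)
        ≤ ENNReal.ofReal (δ' / 2) + ENNReal.ofReal (δ' / 2) := by gcongr
      _ = ENNReal.ofReal δ' := by rw [← ENNReal.ofReal_add (by positivity) (by positivity), add_halves]

end MainTheorem

end FREM

theorem theorem2
    -- the manifold, of dimension `d ≥ 1`, compact, possibly with boundary, embedded in `L²(D)`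
    (d : ℕ) [NeZero d]
    (D : Set ℝ) (hD : IsCompact D)
    [MeasurableSpace (Lp ℝ 2 (volume.restrict D))] [BorelSpace (Lp ℝ 2 (volume.restrict D))]
    {M : Type*} [TopologicalSpace M] [ChartedSpace (EuclideanHalfSpace d) M]
    [IsManifold (𝓡∂ d) ((⊤ : ℕ∞) : WithTop ℕ∞) M] [CompactSpace M]
    [MeasurableSpace M] [BorelSpace M]
    (ι : M → Lp ℝ 2 (volume.restrict D)) (hι : FREM.IsEmbeddedManifold d ι)
    -- the sample, its contaminated version, the errors and the responses
    {Ω : Type*} [MeasurableSpace Ω] (μ : Measure Ω) [IsProbabilityMeasure μ]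
    (X : ℕ → Ω → M) (Xhat : (n : ℕ) → Fin n → Ω → Lp ℝ 2 (volume.restrict D))
    (e : ℕ → Ω → ℝ) (g : M → ℝ) (Y : ℕ → Ω → ℝ)
    (hX_meas : ∀ i, Measurable (X i)) (hX_indep : iIndepFun X μ)
    (hXhat_meas : ∀ n i, Measurable (Xhat n i))
    (he_meas : ∀ i, Measurable (e i)) (he_indep : iIndepFun e μ)
    (he_ident : ∀ i j, IdentDistrib (e i) (e j) μ μ)
    (he_sq : ∀ i, MemLp (e i) 2 μ) (he_mean : ∀ i, ∫ ω, e i ω ∂μ = 0)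
    (he_X : ∀ n : ℕ, IndepFun (fun ω (i : Fin n) => e i ω) (FREM.pairs X Xhat n) μ)
    (hY : ∀ i ω, Y i ω = g (X i ω) + e i ω)
    -- the kernel
    (K : ℝ → ℝ) (hK : FREM.IsSmoothingKernel K)
    -- the density of the predictor on the manifold
    (f : M → ℝ) (hf_meas : Measurable f)
    (hf_bdd : ∃ c₁ c₂ : ℝ, 0 < c₁ ∧ ∀ z, c₁ ≤ f z ∧ f z ≤ c₂)
    (hf_density : ∀ i,
      μ.map (X i) = (FREM.riemVol d ι).withDensity fun z => ENNReal.ofReal (f z))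
    -- smoothness of the regression functional
    (hg : FREM.TwiceDiffBounded d g)
    -- the contaminated predictors: i.i.d., and the contamination level
    (hXhat_indep : ∀ n, iIndepFun (Xhat n) μ)
    (hXhat_ident : ∀ n i j, IdentDistrib (Xhat n i) (Xhat n j) μ μ)
    (β : ℝ) (hβ : 0 < β)
    (η : M → ℝ) (hη_meas : Measurable η) (hη_nonneg : ∀ z, 0 ≤ η z)
    (hη_moments : ∀ (i : ℕ) (p : ℝ), 1 ≤ p → Integrable (fun ω => η (X i ω) ^ p) μ)
    (C : ℝ → ℝ)
    (hcontam : ∀ p : ℝ, 1 ≤ p → ∀ (n : ℕ) (i : Fin n), ∀ᵐ ω ∂μ,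
      (condLExp (MeasurableSpace.comap (X i) inferInstance) μ
        (fun ω' => ‖Xhat n i ω' - ι (X i ω')‖ₑ ^ p) ω) ^ (1 / p) ≤
          ENNReal.ofReal (C p * (n : ℝ) ^ (-β) * η (X i ω)))
    -- the bandwidths
    (hpca hreg : ℕ → ℝ) (ε : ℝ) (hε : 0 < ε)
    (hhpca : FREM.Asymp hpca fun n =>
      (n : ℝ) ^ (-(if 2 / (d : ℝ) ≤ β then 1 / ((d : ℝ) + 2) else β / 2)))
    (hhreg : FREM.Asymp hreg fun n =>
      (n : ℝ) ^ (-(if 3 / ((d : ℝ) + 4) < β then 1 / ((d : ℝ) + 4) else β / (3 + ε * d))))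
    -- the points of estimation, away from the boundary
    (x : ℕ → M) (hx : ∀ᶠ n in atTop, x n ∉ FREM.boundaryLayer d ι (hreg n))
    -- the estimated dimension and the estimated basis of the tangent space
    (dhat : ℕ → Ω → ℕ) (hdhat_meas : ∀ n, Measurable[FREM.pairsSigma X Xhat n] (dhat n))
    (φ : ℕ → ℕ → Ω → Lp ℝ 2 (volume.restrict D))
    (hφ_meas : ∀ n k, Measurable[FREM.pairsSigma X Xhat n] (φ n k))
    (hφ : ∀ n, ∀ᵐ ω ∂μ,
      FREM.IsTopEigenbasis (FREM.localCov (hpca n) (ι (x n)) fun i => Xhat n i ω) (dhat n ω)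
        fun k => φ n k ω) :
    -- the conditional mean squared error on the event that the estimated dimension is correct
    FREM.IsBigOP μ
      (fun n => {ω | dhat n ω = d}.indicator
        (condLExp (FREM.pairsSigma X Xhat n) μ fun ω =>
          ENNReal.ofReal
            ((FREM.gHat K (hreg n) (ι (x n)) (fun i => Xhat n i ω) (fun i => Y i ω) (dhat n ω)
                (fun k => φ n k ω) - g (x n)) ^ 2)))
      (fun n => (n : ℝ) ^ (-(4 / ((d : ℝ) + 4))) + (n : ℝ) ^ (-(4 * β / (3 + ε * d)))) := by
  have : Fact ((2 : ℝ≥0∞) ≠ ⊤) := ⟨ENNReal.ofNat_ne_top⟩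
  exact FREM.isBigOP_condMSE hι hX_meas hX_indep hXhat_meas he_meas he_indep he_ident he_sq he_mean
    he_X hY hK hf_bdd hf_density hg hβ hη_meas hη_nonneg hη_moments hcontam hε hhpca hhreg x
    hdhat_meas hφ_meas hφ
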